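/- Let $\gamma\in(0,1)$ and $d\ge 1$. Let $\mathscr F_d$ be the set of forests (multisets) of non-planar rooted trees with vertices labelled by $\{1,\dots,d\}$, let $\mathscr T_d\subset\mathscr F_d$ be the trees, $|\zeta|$ the number of vertices of $\zeta$, $\lfloor\zeta\rfloor_i$ the tree obtained by joining the trees of $\zeta$ to a new root labelled $i$, and $\mathbf 1$ the empty forest. Let $\langle\mathscr F_d\rangle$ be the free real vector space on $\mathscr F_d$ with the commutative product $\odot$ given by union of forests, and let $\Delta:\langle\mathscr F_d\rangle\to\langle\mathscr F_d\rangle\otimes\langle\mathscr F_d\rangle$ be the Connes–Kreimer coproduct, i.e. the algebra morphism with $\Delta\lfloor\zeta\rfloor_i=\lfloor\zeta\rfloor_i\otimes\mathbf 1+(\mathrm{id}\otimes\lfloor\cdot\rfloor_i)\Delta\zeta$. The branched rough path regularity structure $\mathcal T^{\mathrm b}$ has the model space $T^{\mathrm b}=\langle\mathcal Y\rangle\oplus\langle\dot{\mathcal Y}\rangle$ spanned by the symbols $\mathcal Y=\{\mathbf 1\}\cup\mathscr T_d$ and $\dot{\mathcal Y}=\{\zeta\Xi_i:\zeta\in\mathscr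 F_d,\ 1\le i\le d\}$, with homogeneities $0$ for $\mathbf 1$, $\gamma|\tau|$ for $\tau\in\mathscr T_d$, $\gamma|\zeta|+\gamma-1$ for $\zeta\Xi_i$, and index set $A=\gamma\mathbb N_0\cup(\gamma\mathbb N-1)$. Let $T_\beta$ be the span of the symbols of homogeneity $\beta$, with the Euclidean norm $\|\cdot\|_\beta$ for which these symbols are orthonormal; let $\pi_\beta$ be the projection of $T^{\mathrm b}$ onto $T_\beta$, $\|x\|_\beta:=\|\pi_\beta x\|_\beta$, and let $\pi_{<\eta}$ be the projection onto the span $T_{<\eta}$ of the symbols of homogeneity $<\eta$. The structure group $G$ consists of the maps $(g\otimes\mathrm{id})\Delta^{\mathrm b}$, $g$ a (unital) character of $(\langle\mathscr F_d\rangle,\odot)$, where $\Delta^{\mathrm b}=\Delta$ on $\langle\mathcal Y\rangle$ and $\Delta^{\mathrm b}(\zeta\Xi_i)=\sum\zeta_1\otimes\zeta_2\Xi_i$ if $\Delta\zeta=\sum\zeta_1\otimes\zeta_2$. A model $(\Pi,\Gamma)\in\mathscr M^{\mathrm b}(\mathbb R)$ consists of linear maps $\Pi_s:T^{\mathrm b}\to\mathscr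 S'(\mathbb R)$ and of $\Gamma_{st}\in G$ ($s,t\in\mathbb R$) such that $\Gamma_{ss}=\mathrm{id}$, $\Gamma_{su}\Gamma_{ut}=\Gamma_{st}$, $\Pi_s\Gamma_{st}=\Pi_t$, and for every compact $\mathfrak K\subset\mathbb R$ and every $\beta\in A$ there is a constant $C$ such that, for all $s,t\in\mathfrak K$ and $a\in T_\beta$: $\|\Gamma_{st}a\|_\theta\le C\|a\|_\beta|t-s|^{\beta-\theta}$ for all $\theta\in A$ with $\theta<\beta$, and $|(\Pi_sa)(\delta^{-1}u(\delta^{-1}(\cdot-s)))|\le C\|a\|_\beta\,\delta^\beta$ for all $\delta\in(0,1]$ and all smooth $u$ compactly supported in $(-1,1)$ with $\|u\|_{C^r}\le1$, where $r$ is the smallest integer with $r>|\min A|=1-\gamma$. For $V\in\{\langle\mathcal Y\rangle,\langle\dot{\mathcal Y}\rangle\}$ and $\eta>\min A$, the space $\mathcal D^\eta_\Gamma(\mathbb R,V)$ consists of all $F:\mathbb R\to V\cap T_{<\eta}$ with $$|||F|||_{\eta,\mathfrak K}:=\sup_{t\in\mathfrak K}\sup_{\beta\in A,\,\beta<\eta}\|F(t)\|_\beta+\sup_{\substack{s,t\in\mathfrak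 K\\0<|t-s|\le1}}\ \sup_{\beta\in A,\,\beta<\eta}\frac{\|F(t)-\Gamma_{ts}F(s)\|_\beta}{|t-s|^{\eta-\beta}}<\infty$$ for all compact $\mathfrak K\subset\mathbb R$; it carries the topology of the seminorms $|||\cdot|||_{\eta,\mathfrak K}$. **Theorem.** Let $\alpha>0$, let $f\in C^k(\mathbb R,\mathbb R)$ for some $k\in\mathbb N$ with $k\ge\alpha/\gamma+1$, let $(\Pi,\Gamma)\in\mathscr M^{\mathrm b}(\mathbb R)$ and $i\in\{1,\dots,d\}$. For $Y\in\mathcal D^\alpha_\Gamma(\mathbb R,\langle\mathcal Y\rangle)$ put $$(f(Y)\Xi_i)_{\alpha+\gamma-1}(t):=\sum_{n=0}^{\lfloor\alpha/\gamma\rfloor}\pi_{<\alpha+\gamma-1}\,\frac{f^{(n)}(Y^{\mathbf 1}(t))}{n!}\,\bigl(Y(t)-Y^{\mathbf 1}(t)\mathbf 1\bigr)^{\odot n}\,\Xi_i,$$ where $Y^{\mathbf 1}(t)\mathbf 1:=\pi_0Y(t)$. Then $Y\mapsto(f(Y)\Xi_i)_{\alpha+\gamma-1}$ is a continuous map from $\mathcal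 D^\alpha_\Gamma(\mathbb R,\langle\mathcal Y\rangle)$ into $\mathcal D^{\alpha+\gamma-1}_\Gamma(\mathbb R,\langle\dot{\mathcal Y}\rangle)$. More precisely, for every compact $\mathfrak K\subset\mathbb R$ and every $D>0$ there is $C_{\mathfrak K,D}>0$ such that $$|||(f(F)\Xi_i)_{\alpha+\gamma-1}-(f(G)\Xi_i)_{\alpha+\gamma-1}|||_{\alpha+\gamma-1,\mathfrak K}\le C_{\mathfrak K,D}\,|||F-G|||_{\alpha,\mathfrak K}$$ for all $F,G\in\mathcal D^\alpha_\Gamma(\mathbb R,\langle\mathcal Y\rangle)$ with $|||F|||_{\alpha,\mathfrak K}+|||G|||_{\alpha,\mathfrak K}\le D$. -/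

import Mathlib

open scoped TensorProduct SchwartzMap ENNReal

namespace BranchedRS

noncomputable section

/-! ### Regularity-structure notions over a graded space of symbols

Throughout, the model space is the space `S →₀ ℝ` freely spanned by a set `S` of symbols, graded by
a homogeneity `deg : S → ℝ`. Its index set is `Set.range deg`, and `T_β` is the span of the symbols
of homogeneity `β`, equipped with the norm for which the symbols are orthonormal. -/

section General

variable {S : Type}

/-- The index set `A` of homogeneities. -/
def indexSet (deg : S → ℝ) : Set ℝ := Set.range deg

/-- `T_β`, the homogeneous subspace of homogeneity `β`. -/
def homog (deg : S → ℝ) (β : ℝ) : Submodule ℝ (S →₀ ℝ) :=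
  Finsupp.supported ℝ ℝ {σ | deg σ = β}

/-- `T_{<η}`, the direct sum of all `T_β` with `β < η`. -/
def below (deg : S → ℝ) (η : ℝ) : Submodule ℝ (S →₀ ℝ) :=
  Finsupp.supported ℝ ℝ {σ | deg σ < η}

open scoped Classical in
/-- The projection `π_{<η}` of `T` onto `T_{<η}`. -/
def projBelow (deg : S → ℝ) (η : ℝ) (x : S →₀ ℝ) : S →₀ ℝ :=
  x.filter (fun σ => deg σ < η)

open scoped Classical in
/-- The projection `π_β` of `T` onto `T_β`. -/
def projHomog (deg : S → ℝ) (β : ℝ) (x : S →₀ ℝ) : S →₀ ℝ :=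
  x.filter (fun σ => deg σ = β)

/-- The seminorm `‖x‖_β = ‖π_β x‖_β`; on `T_β` it is the Euclidean norm in the basis of symbols. -/
def homNorm (deg : S → ℝ) (β : ℝ) (x : S →₀ ℝ) : ℝ :=
  Real.sqrt ((projHomog deg β x).sum fun _ c => c ^ 2)

/-- A `G`-bimap over `ℝ`. -/
structure IsBimap (deg : S → ℝ) (G : Set ((S →₀ ℝ) →ₗ[ℝ] (S →₀ ℝ)))
    (Γ : ℝ → ℝ → ((S →₀ ℝ) →ₗ[ℝ] (S →₀ ℝ))) : Prop where
  mem : ∀ x y, Γ x y ∈ G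
  self : ∀ x, Γ x x = LinearMap.id
  comp : ∀ x y z, Γ x y ∘ₗ Γ y z = Γ x z
  bound : ∀ K : Set ℝ, IsCompact K → ∀ β ∈ indexSet deg, ∃ C : ℝ, ∀ x ∈ K, ∀ y ∈ K,
    ∀ a ∈ homog deg β, ∀ θ ∈ indexSet deg, θ < β →
      homNorm deg θ (Γ x y a) ≤ C * homNorm deg β a * dist x y ^ (β - θ)

/-- The rescaled test function `y ↦ δ⁻¹ u (δ⁻¹ (y - x))`. -/
def rescale (x : ℝ) (δ : ℝ) (hδ : 0 < δ) (u : 𝓢(ℝ, ℝ)) : 𝓢(ℝ, ℝ) :=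
  δ⁻¹ • SchwartzMap.compSubConstCLM ℝ x
    (SchwartzMap.compCLMOfContinuousLinearEquiv ℝ
      (ContinuousLinearEquiv.unitsEquivAut ℝ (Units.mk0 δ⁻¹ (inv_ne_zero hδ.ne'))) u)

theorem rescale_apply (x : ℝ) (δ : ℝ) (hδ : 0 < δ) (u : 𝓢(ℝ, ℝ)) (y : ℝ) :
    rescale x δ hδ u y = δ⁻¹ * u (δ⁻¹ * (y - x)) := by
  simp [rescale, mul_comm]

/-- Test functions compactly supported in the open unit ball with `C^r` norm at most one. -/
def testFunctions (r : ℕ) : Set 𝓢(ℝ, ℝ) :=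
  {u | tsupport u ⊆ Metric.ball 0 1 ∧ ∀ n ≤ r, ∀ x, |iteratedDeriv n u x| ≤ 1}

/-- The smallest natural number `r` with `r > |min A|`. -/
def testOrder (deg : S → ℝ) : ℕ := sInf {r : ℕ | |sInf (indexSet deg)| < r}

/-- Models on `ℝ` for the regularity structure with homogeneity `deg` and structure group `G`.
The map `Pi x` takes values in the (real) tempered distributions; as the homogeneous subspaces are
finite-dimensional in the case of interest, no continuity in the first argument has to be added. -/
structure Model (deg : S → ℝ) (G : Set ((S →₀ ℝ) →ₗ[ℝ] (S →₀ ℝ))) where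
  Pi : ℝ → ((S →₀ ℝ) →ₗ[ℝ] (𝓢(ℝ, ℝ) →L[ℝ] ℝ))
  Gam : ℝ → ℝ → ((S →₀ ℝ) →ₗ[ℝ] (S →₀ ℝ))
  isBimap : IsBimap deg G Gam
  compat : ∀ x y, Pi x ∘ₗ Gam x y = Pi y
  bound : ∀ K : Set ℝ, IsCompact K → ∀ β ∈ indexSet deg, ∃ C : ℝ, ∀ x ∈ K,
    ∀ (δ : ℝ) (hδ : 0 < δ), δ ≤ 1 → ∀ a ∈ homog deg β, ∀ u ∈ testFunctions (testOrder deg),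
      |Pi x a (rescale x δ hδ u)| ≤ C * homNorm deg β a * δ ^ β

/-- The (possibly infinite) quantity `|||F|||_{η,K}` of a map `F : ℝ → T`. -/
def mdNorm (deg : S → ℝ) (Γ : ℝ → ℝ → ((S →₀ ℝ) →ₗ[ℝ] (S →₀ ℝ))) (η : ℝ) (K : Set ℝ)
    (F : ℝ → (S →₀ ℝ)) : ℝ≥0∞ :=
  (⨆ x ∈ K, ⨆ β ∈ indexSet deg ∩ Set.Iio η, ENNReal.ofReal (homNorm deg β (F x))) +
  ⨆ x ∈ K, ⨆ y ∈ K, ⨆ (_ : 0 < dist x y ∧ dist x y ≤ 1), ⨆ β ∈ indexSet deg ∩ Set.Iio η,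
    ENNReal.ofReal (homNorm deg β (F x - Γ x y (F y)) / dist x y ^ (η - β))

/-- The space `D^η_Γ(ℝ, V)` of modelled distributions of order `η` with values in `V_{<η}`. -/
structure ModelledDistribution (deg : S → ℝ) (Γ : ℝ → ℝ → ((S →₀ ℝ) →ₗ[ℝ] (S →₀ ℝ)))
    (V : Submodule ℝ (S →₀ ℝ)) (η : ℝ) where
  toFun : ℝ → (S →₀ ℝ)
  mem : ∀ t, toFun t ∈ V ⊓ below deg η
  finite : ∀ K : Set ℝ, IsCompact K → mdNorm deg Γ η K toFun < ⊤

instance (deg : S → ℝ) (Γ : ℝ → ℝ → ((S →₀ ℝ) →ₗ[ℝ] (S →₀ ℝ)))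
    (V : Submodule ℝ (S →₀ ℝ)) (η : ℝ) :
    CoeFun (ModelledDistribution deg Γ V η) (fun _ => ℝ → (S →₀ ℝ)) :=
  ⟨ModelledDistribution.toFun⟩

/-- The topology of the family of seminorms `|||·|||_{η,K}`, `K` compact. -/
instance (deg : S → ℝ) (Γ : ℝ → ℝ → ((S →₀ ℝ) →ₗ[ℝ] (S →₀ ℝ)))
    (V : Submodule ℝ (S →₀ ℝ)) (η : ℝ) :
    TopologicalSpace (ModelledDistribution deg Γ V η) :=
  TopologicalSpace.generateFrom
    {U | ∃ (K : Set ℝ) (F : ModelledDistribution deg Γ V η) (ε : ℝ≥0∞), IsCompact K ∧ 0 < ε ∧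
      U = {H : ModelledDistribution deg Γ V η |
        mdNorm deg Γ η K (fun t => H t - F t) < ε}}

end General

/-! ### Decorated trees and forests -/

section Trees

/-- The functor sending `α` to pairs of a label and a multiset of elements of `α`. -/
def Branch (d : ℕ) (α : Type) : Type := Fin d × Multiset α

instance (d : ℕ) : Functor (Branch d) where
  map f p := (p.1, p.2.map f)

instance (d : ℕ) : QPF (Branch d) where
  P := ⟨Fin d × ℕ, fun p => Fin p.2⟩
  abs := fun p => (p.1.1, (List.ofFn p.2 : Multiset _))
  repr := fun x => ⟨(x.1, x.2.toList.length), fun j => x.2.toList.get j⟩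
  abs_repr := by
    intro α x
    change (x.1, ((List.ofFn x.2.toList.get : List α) : Multiset α)) = x
    rw [List.ofFn_get, Multiset.coe_toList]
    rfl
  abs_map := by
    intro α β f p
    change (p.1.1, ((List.ofFn (f ∘ p.2) : List β) : Multiset β)) =
      (p.1.1, Multiset.map f ((List.ofFn p.2 : List α) : Multiset α))
    rw [Multiset.map_coe, List.map_ofFn]

/-- Non-planar rooted trees with vertices decorated by `{1, …, d}`: a tree is a label of its root
together with the multiset of its branches (initial algebra of `Branch d`). -/
def Tree (d : ℕ) : Type := QPF.Fix (Branch d)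

/-- Forests are multisets of trees; the product `⊙` is the sum of multisets and the empty forest
`𝟏` is the empty multiset. -/
abbrev Forest (d : ℕ) : Type := Multiset (Tree d)

variable {d : ℕ}

/-- The tree `⌊ζ⌋_i` obtained by joining the trees of `ζ` to a new root labelled `i`. -/
def node (i : Fin d) (ζ : Forest d) : Tree d := QPF.Fix.mk (F := Branch d) (i, ζ)

/-- The label of the root. -/
def rootLabel (τ : Tree d) : Fin d := (QPF.Fix.dest (F := Branch d) τ).1

/-- The forest of branches at the root. -/
def branches (τ : Tree d) : Forest d := (QPF.Fix.dest (F := Branch d) τ).2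

theorem rootLabel_node (i : Fin d) (ζ : Forest d) : rootLabel (node i ζ) = i :=
  congrArg Prod.fst (QPF.Fix.dest_mk (F := Branch d) (i, ζ))

theorem branches_node (i : Fin d) (ζ : Forest d) : branches (node i ζ) = ζ :=
  congrArg Prod.snd (QPF.Fix.dest_mk (F := Branch d) (i, ζ))

theorem node_rootLabel_branches (τ : Tree d) : node (rootLabel τ) (branches τ) = τ :=
  QPF.Fix.mk_dest (F := Branch d) τ

theorem Tree.induction {p : Tree d → Prop}
    (h : ∀ i ζ, (∀ τ ∈ ζ, p τ) → p (node i ζ)) (τ : Tree d) : p τ := by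
  refine QPF.Fix.ind (F := Branch d) p ?_ τ
  rintro ⟨i, ζ⟩ ⟨⟨j, u⟩, hu⟩
  have h2 : Multiset.map Subtype.val u = ζ := congrArg Prod.snd hu
  refine h i ζ fun τ hτ => ?_
  rw [← h2] at hτ
  obtain ⟨σ, -, rfl⟩ := Multiset.mem_map.1 hτ
  exact σ.2

/-- Recursion on trees. -/
def Tree.fold {β : Type} (g : Fin d → Multiset β → β) : Tree d → β :=
  QPF.Fix.rec (F := Branch d) (fun p => g p.1 p.2)

theorem Tree.fold_node {β : Type} (g : Fin d → Multiset β → β) (i : Fin d) (ζ : Forest d) :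
    Tree.fold g (node i ζ) = g i (ζ.map (Tree.fold g)) :=
  QPF.Fix.rec_eq (F := Branch d) (fun p => g p.1 p.2) (i, ζ)

/-- The number of vertices of a tree. -/
def Tree.size : Tree d → ℕ := Tree.fold fun _ s => s.sum + 1

/-- The number of vertices of a forest. -/
def forestSize (ζ : Forest d) : ℕ := (ζ.map Tree.size).sum

theorem size_node (i : Fin d) (ζ : Forest d) : (node i ζ).size = forestSize ζ + 1 :=
  Tree.fold_node _ i ζ

/-! ### The Connes-Kreimer Hopf algebra -/

/-- The algebra `⟨F_d⟩` of linear combinations of forests with product `⊙`. -/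
abbrev ForestAlg (d : ℕ) : Type := AddMonoidAlgebra ℝ (Forest d)

/-- A forest as an element of the forest algebra. -/
def ofForest (ζ : Forest d) : ForestAlg d := AddMonoidAlgebra.single ζ 1

/-- The linear map on the forest algebra with prescribed values on forests. -/
def linExt {M : Type} [AddCommGroup M] [Module ℝ M] (φ : Forest d → M) : ForestAlg d →ₗ[ℝ] M :=
  Finsupp.linearCombination ℝ φ ∘ₗ (AddMonoidAlgebra.coeffLinearEquiv ℝ).toLinearMap

theorem linExt_ofForest {M : Type} [AddCommGroup M] [Module ℝ M] (φ : Forest d → M)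
    (ζ : Forest d) : linExt φ (ofForest ζ) = φ ζ := by
  simp [linExt, ofForest]

/-- The linear extension of `⌊·⌋_i`. -/
def graft (i : Fin d) : ForestAlg d →ₗ[ℝ] ForestAlg d := linExt fun ζ => ofForest {node i ζ}

/-- The pair of a tree `τ` and its coproduct, by recursion on `τ`. -/
def coprodTreeAux : Tree d → Tree d × (ForestAlg d ⊗[ℝ] ForestAlg d) :=
  Tree.fold fun i s =>
    (node i (s.map Prod.fst),
      ofForest {node i (s.map Prod.fst)} ⊗ₜ[ℝ] 1 +
        (graft i).lTensor (ForestAlg d) (s.map Prod.snd).prod)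

/-- The coproduct of a tree, see `coprodTree_node`. -/
def coprodTree (τ : Tree d) : ForestAlg d ⊗[ℝ] ForestAlg d := (coprodTreeAux τ).2

/-- The Connes-Kreimer coproduct, the algebra morphism extending `coprodTree`. -/
def coprod : ForestAlg d →ₐ[ℝ] ForestAlg d ⊗[ℝ] ForestAlg d :=
  AddMonoidAlgebra.lift ℝ (ForestAlg d ⊗[ℝ] ForestAlg d) (Forest d)
    { toFun := fun ζ => ((Multiplicative.toAdd ζ).map coprodTree).prod
      map_one' := by simp
      map_mul' := by simp }

theorem coprod_ofForest (ζ : Forest d) : coprod (ofForest ζ) = (ζ.map coprodTree).prod := by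
  rw [coprod, ofForest, AddMonoidAlgebra.lift_single, one_smul]
  rfl

theorem coprodTreeAux_fst (τ : Tree d) : (coprodTreeAux τ).1 = τ := by
  induction τ using Tree.induction with
  | h i ζ ih =>
    have h : (ζ.map coprodTreeAux).map Prod.fst = ζ := by
      rw [Multiset.map_map]
      conv_rhs => rw [← Multiset.map_id ζ]
      exact Multiset.map_congr rfl ih
    unfold coprodTreeAux at h ⊢
    rw [Tree.fold_node, h]

/-- The defining recursion `Δ⌊ζ⌋_i = ⌊ζ⌋_i ⊗ 𝟏 + (id ⊗ ⌊·⌋_i) Δζ`. -/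
theorem coprodTree_node (i : Fin d) (ζ : Forest d) :
    coprodTree (node i ζ) =
      ofForest {node i ζ} ⊗ₜ[ℝ] 1 + (graft i).lTensor (ForestAlg d) (coprod (ofForest ζ)) := by
  have h : (ζ.map coprodTreeAux).map Prod.fst = ζ := by
    rw [Multiset.map_map]
    conv_rhs => rw [← Multiset.map_id ζ]
    exact Multiset.map_congr rfl fun τ _ => coprodTreeAux_fst τ
  have h2 : (ζ.map coprodTreeAux).map Prod.snd = ζ.map coprodTree := by
    rw [Multiset.map_map]; rfl
  rw [coprod_ofForest, ← h2]
  unfold coprodTree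
  unfold coprodTreeAux at h ⊢
  rw [Tree.fold_node, h]

end Trees

/-! ### The branched rough path regularity structure -/

section Branched

/-- The symbols `𝟏`, `τ` (trees) and `ζ Ξ_i` (forest `ζ`, label `i`). -/
inductive Sym (d : ℕ) : Type
  | unit : Sym d
  | tree (τ : Tree d) : Sym d
  | noise (ζ : Forest d) (i : Fin d) : Sym d

variable {d : ℕ}

/-- Homogeneities: `|𝟏| = 0`, `|τ| = γ·size`, `|ζ Ξ_i| = γ·size + γ - 1`. -/
def homogeneity (γ : ℝ) : Sym d → ℝ
  | .unit => 0
  | .tree τ => γ * τ.size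
  | .noise ζ _ => γ * forestSize ζ + γ - 1

/-- The model space `T^b`. -/
abbrev ModelSpace (d : ℕ) : Type := Sym d →₀ ℝ

/-- The sector `⟨𝒴⟩` spanned by `𝟏` and the trees. -/
def sectorY (d : ℕ) : Submodule ℝ (ModelSpace d) :=
  Finsupp.supported ℝ ℝ {σ | σ = .unit ∨ ∃ τ, σ = .tree τ}

/-- The sector `⟨𝒴̇⟩` spanned by the symbols `ζ Ξ_i`. -/
def sectorYdot (d : ℕ) : Submodule ℝ (ModelSpace d) :=
  Finsupp.supported ℝ ℝ {σ | ∃ ζ i, σ = .noise ζ i}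

/-- Multiplication by `Ξ_i`, the linear map `ζ ↦ ζ Ξ_i`. -/
def mulXi (i : Fin d) : ForestAlg d →ₗ[ℝ] ModelSpace d :=
  linExt fun ζ => Finsupp.single (.noise ζ i) 1

/-- The linear map `ζ ↦ ⌊ζ⌋_i`, with `⌊ζ⌋_i` regarded as a symbol of the model space. -/
def graftSym (i : Fin d) : ForestAlg d →ₗ[ℝ] ModelSpace d :=
  linExt fun ζ => Finsupp.single (.tree (node i ζ)) 1

/-- The identification of `⟨𝒴⟩` with a subspace of the forest algebra (extended by zero to the
symbols `ζ Ξ_i`). -/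
def toForestAlg : ModelSpace d →ₗ[ℝ] ForestAlg d :=
  Finsupp.linearCombination ℝ fun
    | .unit => 1
    | .tree τ => ofForest {τ}
    | .noise _ _ => 0

/-- The comodule map `Δ^b : T^b → ⟨F_d⟩ ⊗ T^b`: on `ζ Ξ_i` it is `Δ` applied to `ζ`, and on `⟨𝒴⟩` it
is `Δ` itself (see `toForestAlg_coaction_tree`). -/
def coaction : ModelSpace d →ₗ[ℝ] ForestAlg d ⊗[ℝ] ModelSpace d :=
  Finsupp.linearCombination ℝ fun
    | .unit => 1 ⊗ₜ[ℝ] Finsupp.single .unit 1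
    | .tree τ => ofForest {τ} ⊗ₜ[ℝ] Finsupp.single .unit 1 +
        (graftSym (rootLabel τ)).lTensor (ForestAlg d) (coprod (ofForest (branches τ)))
    | .noise ζ i => (mulXi i).lTensor (ForestAlg d) (coprod (ofForest ζ))

theorem toForestAlg_coaction_tree (τ : Tree d) :
    toForestAlg.lTensor (ForestAlg d) (coaction (Finsupp.single (.tree τ) 1)) =
      coprod (ofForest {τ}) := by
  have h : toForestAlg ∘ₗ graftSym (rootLabel τ) = graft (rootLabel τ) := by
    ext ζ
    simp [toForestAlg, graftSym, graft, linExt]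
  rw [coprod_ofForest, Multiset.map_singleton, Multiset.prod_singleton]
  conv_rhs => rw [← node_rootLabel_branches τ, coprodTree_node, node_rootLabel_branches, ← h]
  simp [coaction, LinearMap.lTensor_comp, toForestAlg]

/-- The action `(g ⊗ id) Δ^b` of a character `g` of the forest algebra. -/
def structAction (g : ForestAlg d →ₐ[ℝ] ℝ) : ModelSpace d →ₗ[ℝ] ModelSpace d :=
  (TensorProduct.lid ℝ (ModelSpace d)).toLinearMap ∘ₗ
    g.toLinearMap.rTensor (ModelSpace d) ∘ₗ coaction

/-- The structure group of the branched rough path regularity structure. -/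
def structureGroup (d : ℕ) : Set (ModelSpace d →ₗ[ℝ] ModelSpace d) := Set.range structAction

/-- The set of models on `ℝ` for the branched rough path regularity structure. -/
abbrev BranchedModel (d : ℕ) (γ : ℝ) : Type :=
  Model (homogeneity (d := d) γ) (structureGroup d)

/-- The coefficient `y^𝟏` of the unit symbol. -/
def unitCoeff (y : ModelSpace d) : ℝ := y .unit

/-- The value `∑_{n ≤ ⌊α/γ⌋} π_{<α+γ-1} (f⁽ⁿ⁾(y^𝟏)/n!) (y - y^𝟏 𝟏)^{⊙n} Ξ_i`. -/
def taylorLift (γ α : ℝ) (f : ℝ → ℝ) (i : Fin d) (y : ModelSpace d) : ModelSpace d :=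
  ∑ n ∈ Finset.range (⌊α / γ⌋₊ + 1),
    projBelow (homogeneity γ) (α + γ - 1)
      ((iteratedDeriv n f (unitCoeff y) / (n.factorial : ℝ)) •
        mulXi i (toForestAlg (y - Finsupp.single .unit (unitCoeff y)) ^ n))

end Branched

end

end BranchedRS

/-!
A structure group element `(g ⊗ id) Δ` acts on the forest algebra by an algebra morphism `A`, so
it commutes with `⊙` and with the Taylor sums `∑ f⁽ⁿ⁾(c)/n! (x - c)ⁿ` defining `f(x)`. With
`r = |t - s| ^ γ` and `P = ⌈α / γ⌉`, all the bounds of degree `β < α` on `y = F(t) - Γ_{ts} F(s)`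
amount to one bound `≲ |t - s| ^ α` on the submultiplicative seminorm
`∑_{|ζ| < P} r ^ |ζ| |y_ζ|`. In this seminorm `A (f(x'))` and `f(x)` are compared by re-expanding
the Taylor sum about a new base point. For the local Lipschitz bound one goes along the segment
from `G` to `F`: up to forests with at least `P` vertices, the derivative of `θ ↦ f(x + θ v)` is
`f'(x + θ v) ⊙ v`, so that only a bound on the increments of `f'(Y) ⊙ V` which is linear in `V` is
needed. This costs one derivative, hence `f ∈ C^(P + 1)`.
-/

namespace BranchedRS

noncomputable section

/-! ### Taylor sums in commutative algebras -/

section Taylor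

variable {H H' : Type*} [CommRing H] [Algebra ℝ H] [CommRing H'] [Algebra ℝ H']

/-- The Taylor polynomial `∑_{n < P} g⁽ⁿ⁾(a)/n! xⁿ` of `g` at the base point `a`, evaluated at the
increment `x` in a commutative algebra. -/
def taylorSum (g : ℝ → ℝ) (P : ℕ) (a : ℝ) (x : H) : H :=
  ∑ n ∈ Finset.range P, (iteratedDeriv n g a / n.factorial) • x ^ n

theorem map_taylorSum (φ : H →ₐ[ℝ] H') (g : ℝ → ℝ) (P : ℕ) (a : ℝ) (x : H) :
    φ (taylorSum g P a x) = taylorSum g P a (φ x) := by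
  simp [taylorSum]

theorem iteratedDeriv_iteratedDeriv (n j : ℕ) (g : ℝ → ℝ) :
    iteratedDeriv n (iteratedDeriv j g) = iteratedDeriv (n + j) g := by
  simp only [iteratedDeriv_eq_iterate, Function.iterate_add_apply]

theorem taylorSum_add_smul_one (g : ℝ → ℝ) (P : ℕ) (a c : ℝ) (z : H) :
    taylorSum g P a (z + c • 1) = ∑ j ∈ Finset.range P,
      (taylorSum (iteratedDeriv j g) (P - j) a c / j.factorial) • z ^ j := by
  have binomial_term (m j : ℕ) (hj : j ≤ m) :
      (iteratedDeriv m g a / m.factorial) • (z ^ j * (c • (1 : H)) ^ (m - j) * m.choose j) =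
        (iteratedDeriv (m - j + j) g a / (m - j).factorial * c ^ (m - j) / j.factorial) •
          z ^ j := by
    have hchoose : (m.choose j : H) = (m.choose j : ℝ) • 1 := by
      rw [Nat.cast_smul_eq_nsmul, nsmul_eq_mul, mul_one]
    have := m.factorial_ne_zero
    rw [hchoose, smul_pow, one_pow, Nat.cast_choose ℝ hj, Nat.sub_add_cancel hj]
    simp only [mul_smul_comm, mul_one, smul_smul]
    congr 1
    field_simp
  calc taylorSum g P a (z + c • 1)
      = ∑ m ∈ Finset.range P, ∑ j ∈ Finset.range (m + 1),
          (iteratedDeriv (m - j + j) g a / (m - j).factorial * c ^ (m - j) / j.factorial) •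
            z ^ j := by
        refine Finset.sum_congr rfl fun m _ => ?_
        rw [add_pow, Finset.smul_sum]
        exact Finset.sum_congr rfl fun j hj =>
          binomial_term m j (Nat.lt_succ_iff.1 (Finset.mem_range.1 hj))
    _ = _ := by
        rw [Finset.sum_range_diag_flip P fun j n =>
          (iteratedDeriv (n + j) g a / n.factorial * c ^ n / j.factorial) • z ^ j]
        simp only [taylorSum, iteratedDeriv_iteratedDeriv, Finset.sum_div, Finset.sum_smul,
          smul_eq_mul]

theorem abs_sub_taylorSum_le {g : ℝ → ℝ} {N : ℕ} (hg : ContDiff ℝ N g) {B D : ℝ}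
    (hB : ∀ x, |x| ≤ D → |iteratedDeriv N g x| ≤ B) {a b : ℝ} (ha : |a| ≤ D) (hb : |b| ≤ D) :
    |g b - taylorSum g N a (b - a)| ≤ B * |b - a| ^ N := by
  have : 0 ≤ B := (abs_nonneg _).trans (hB a ha)
  rcases N with _ | N
  · simpa [taylorSum] using hB b hb
  rcases eq_or_ne a b with rfl | hab
  · simp [taylorSum, Finset.sum_range_succ']
  obtain ⟨c, hc, hlagrange⟩ := taylor_mean_remainder_lagrange_iteratedDeriv hab
    (n := N) (by exact_mod_cast hg.contDiffOn)
  have htaylor : taylorWithinEval g N (Set.uIcc a b) a b = taylorSum g (N + 1) a (b - a) := by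
    rw [taylor_within_apply, taylorSum]
    refine Finset.sum_congr rfl fun n hn => ?_
    have hn : (n : WithTop ℕ∞) ≤ (N + 1 : ℕ) := by exact_mod_cast (Finset.mem_range.1 hn).le
    rw [iteratedDerivWithin_eq_iteratedDeriv (uniqueDiffOn_uIcc hab) (hg.of_le hn).contDiffAt
      Set.left_mem_uIcc]
    simp only [smul_eq_mul]
    ring
  have hcD : |c| ≤ D := abs_le.2 <| Set.uIcc_subset_Icc (abs_le.1 ha) (abs_le.1 hb)
    (Set.Ioo_subset_Icc_self hc)
  rw [← htaylor, hlagrange, abs_div, Nat.abs_cast, abs_mul, abs_pow]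
  exact (div_le_self (by positivity) (by exact_mod_cast (N + 1).factorial_pos)).trans
    (by gcongr; exact hB c hcD)

open Polynomial in
theorem hasDerivAt_linearMap_eval (ℓ : H →ₗ[ℝ] ℝ) (q : H[X]) (θ : ℝ) :
    HasDerivAt (fun θ : ℝ => ℓ (q.eval (algebraMap ℝ H θ)))
      (ℓ (q.derivative.eval (algebraMap ℝ H θ))) θ := by
  induction q using Polynomial.induction_on' with
  | add q₁ q₂ h₁ h₂ => simpa using h₁.fun_add h₂
  | monomial n a =>
    have hmonomial (m : ℕ) (b : H) (x : ℝ) :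
        ℓ ((monomial m b).eval (algebraMap ℝ H x)) = x ^ m * ℓ b := by
      rw [eval_monomial, ← map_pow, mul_comm, ← Algebra.smul_def, map_smul, smul_eq_mul]
    have hcast : ℓ (a * n) = n * ℓ a := by
      rw [mul_comm, ← nsmul_eq_mul, map_nsmul, nsmul_eq_mul]
    simp only [derivative_monomial, hmonomial, hcast]
    exact ((hasDerivAt_pow n θ).mul_const (ℓ a)).congr_deriv (by ring)

open Polynomial in
theorem hasDerivAt_linearMap_line_pow (ℓ : H →ₗ[ℝ] ℝ) (x v : H) (n : ℕ) (θ : ℝ) :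
    HasDerivAt (fun θ : ℝ => ℓ ((x + θ • v) ^ n)) (n * ℓ ((x + θ • v) ^ (n - 1) * v)) θ := by
  have h := hasDerivAt_linearMap_eval ℓ ((C x + X * C v) ^ n) θ
  simp only [derivative_pow, eval_mul, eval_pow, eval_add, eval_C, eval_X,
    derivative_add, derivative_mul, derivative_C, derivative_X, one_mul, mul_zero, add_zero,
    zero_add, ← Algebra.smul_def, mul_assoc] at h
  rwa [← nsmul_eq_mul, map_nsmul, nsmul_eq_mul] at h

theorem sum_div_factorial_mul_natCast_mul_pred (F c : ℕ → ℝ) (P : ℕ) (hc : c (P - 1) = 0) :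
    ∑ n ∈ Finset.range P, F n / n.factorial * (n * c (n - 1)) =
      ∑ n ∈ Finset.range P, F (n + 1) / n.factorial * c n := by
  rcases P with _ | P
  · simp
  rw [Nat.add_sub_cancel] at hc
  rw [Finset.sum_range_succ', Finset.sum_range_succ, hc]
  simp only [CharP.cast_eq_zero, zero_mul, mul_zero, add_zero, Nat.add_sub_cancel]
  refine Finset.sum_congr rfl fun n _ => ?_
  have := n.factorial_ne_zero
  rw [Nat.factorial_succ]
  push_cast
  field_simp

/-- Truncating the Taylor sum loses the top order term of the chain rule, which `hℓ` discards. -/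
theorem hasDerivAt_linearMap_taylorSum {f : ℝ → ℝ} {P : ℕ} (hf : ContDiff ℝ P f) (y v : ℝ)
    (x w : H) (ℓ : H →ₗ[ℝ] ℝ) (θ : ℝ) (hℓ : ℓ ((x + θ • w) ^ (P - 1) * w) = 0) :
    HasDerivAt (fun θ : ℝ => ℓ (taylorSum f P (y + θ * v) (x + θ • w)))
      (ℓ (taylorSum (deriv f) P (y + θ * v) (x + θ • w) * (v • 1 + w))) θ := by
  have hterm (n : ℕ) (hn : n ∈ Finset.range P) : HasDerivAt
      (fun θ : ℝ => iteratedDeriv n f (y + θ * v) / n.factorial * ℓ ((x + θ • w) ^ n))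
      (iteratedDeriv (n + 1) f (y + θ * v) * v / n.factorial * ℓ ((x + θ • w) ^ n) +
        iteratedDeriv n f (y + θ * v) / n.factorial * (n * ℓ ((x + θ • w) ^ (n - 1) * w))) θ := by
    have hderiv : HasDerivAt (iteratedDeriv n f) (iteratedDeriv (n + 1) f (y + θ * v))
        (y + θ * v) := by
      rw [iteratedDeriv_succ]
      exact (hf.differentiable_iteratedDeriv n
        (by exact_mod_cast Finset.mem_range.1 hn) _).hasDerivAt
    have hline : HasDerivAt (fun θ : ℝ => y + θ * v) v θ := by
      simpa using ((hasDerivAt_id θ).mul_const v).const_add y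
    exact ((hderiv.comp θ hline).div_const _).mul (hasDerivAt_linearMap_line_pow ℓ x w n θ)
  have hsum := HasDerivAt.fun_sum hterm
  rw [Finset.sum_add_distrib, sum_div_factorial_mul_natCast_mul_pred
    (fun n => iteratedDeriv n f (y + θ * v)) (fun n => ℓ ((x + θ • w) ^ n * w)) P hℓ] at hsum
  have hexpand (θ : ℝ) : ℓ (taylorSum f P (y + θ * v) (x + θ • w)) = ∑ n ∈ Finset.range P,
      iteratedDeriv n f (y + θ * v) / n.factorial * ℓ ((x + θ • w) ^ n) := by
    simp [taylorSum]
  simp only [hexpand]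
  refine hsum.congr_deriv ?_
  simp only [taylorSum, mul_add, mul_smul_comm, mul_one, Finset.sum_mul, smul_mul_assoc,
    map_add, map_smul, map_sum, smul_eq_mul, Finset.mul_sum, ← iteratedDeriv_succ']
  congr 1
  exact Finset.sum_congr rfl fun n _ => by ring

end Taylor

/-! ### Submultiplicative seminorms -/

section Seminorm

theorem seminorm_line_le {E : Type*} [AddCommGroup E] [Module ℝ E] (p : Seminorm ℝ E) {x y : E}
    {c : ℝ} (hx : p x ≤ c) (hy : p y ≤ c) {θ : ℝ} (hθ : θ ∈ Set.Icc (0 : ℝ) 1) :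
    p (x + θ • (y - x)) ≤ c :=
  p.mem_closedBall_zero.1 <| (p.convex_closedBall 0 c).add_smul_sub_mem
    (p.mem_closedBall_zero.2 hx) (p.mem_closedBall_zero.2 hy) hθ

theorem seminorm_sum_smul_le {E : Type*} [AddCommGroup E] [Module ℝ E] (p : Seminorm ℝ E) {P : ℕ}
    {c : ℕ → ℝ} {x : ℕ → E} {B M : ℝ} (hc : ∀ n < P, |c n| ≤ B) (hx : ∀ n < P, p (x n) ≤ M) :
    p (∑ n ∈ Finset.range P, c n • x n) ≤ P * (B * M) := by
  refine (Finset.le_sum_of_subadditive p (map_zero p).le (map_add_le_add p) _ _).trans ?_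
  refine (Finset.sum_le_card_nsmul _ _ (B * M) fun n hn => ?_).trans (by simp)
  have hn := Finset.mem_range.1 hn
  rw [map_smul_eq_mul, Real.norm_eq_abs]
  exact mul_le_mul (hc n hn) (hx n hn) (apply_nonneg p _) ((abs_nonneg _).trans (hc n hn))

theorem abs_div_factorial_le {x B : ℝ} (h : |x| ≤ B) (n : ℕ) : |x / n.factorial| ≤ B := by
  rw [abs_div, Nat.abs_cast]
  exact (div_le_self (abs_nonneg _) (by exact_mod_cast n.factorial_pos)).trans h

variable {H : Type*} [CommRing H] [Algebra ℝ H]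

/-- Algebra seminorms: submultiplicative seminorms whose value at the unit is at most one. -/
structure IsAlgSeminorm (p : Seminorm ℝ H) : Prop where
  mul_le : ∀ x y, p (x * y) ≤ p x * p y
  one_le : p 1 ≤ 1

namespace IsAlgSeminorm

variable {p : Seminorm ℝ H} (hp : IsAlgSeminorm p) {g : ℝ → ℝ} {P : ℕ} {B M : ℝ} {a b : ℝ} {x y : H}
include hp

theorem pow_le (hx : p x ≤ M) (n : ℕ) : p (x ^ n) ≤ M ^ n := by
  have hM := (apply_nonneg p x).trans hx
  induction n with
  | zero => simpa using hp.one_le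
  | succ n ih =>
    rw [pow_succ, pow_succ]
    exact (hp.mul_le _ _).trans (mul_le_mul ih hx (apply_nonneg _ _) (by positivity))

theorem pow_sub_pow_le (hM : 1 ≤ M) (hx : p x ≤ M) (hy : p y ≤ M) (n : ℕ) :
    p (x ^ n - y ^ n) ≤ n * M ^ n * p (x - y) := by
  induction n with
  | zero => simp
  | succ n ih =>
    calc p (x ^ (n + 1) - y ^ (n + 1))
        = p (x * (x ^ n - y ^ n) + (x - y) * y ^ n) := by ring_nf
      _ ≤ p x * p (x ^ n - y ^ n) + p (x - y) * p (y ^ n) :=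
          (map_add_le_add _ _ _).trans (add_le_add (hp.mul_le _ _) (hp.mul_le _ _))
      _ ≤ M * (n * M ^ n * p (x - y)) + p (x - y) * M ^ (n + 1) := by
          gcongr
          exact (hp.pow_le hy n).trans (pow_le_pow_right₀ hM n.le_succ)
      _ = (n + 1 : ℕ) * M ^ (n + 1) * p (x - y) := by push_cast; ring

theorem mul_sub_mul_le (x x' y y' : H) :
    p (x * y - x' * y') ≤ p (x - x') * p y + p x' * p (y - y') := by
  calc p (x * y - x' * y') = p ((x - x') * y + x' * (y - y')) := by ring_nf
    _ ≤ _ := (map_add_le_add _ _ _).trans (add_le_add (hp.mul_le _ _) (hp.mul_le _ _))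

theorem taylorSum_le (hM : 1 ≤ M) (hB : ∀ n < P, |iteratedDeriv n g a| ≤ B) (hx : p x ≤ M) :
    p (taylorSum g P a x) ≤ P * (B * M ^ P) :=
  seminorm_sum_smul_le p (fun n hn => abs_div_factorial_le (hB n hn) n) fun n hn =>
    (hp.pow_le hx n).trans (pow_le_pow_right₀ hM hn.le)

theorem taylorSum_sub_le (hM : 1 ≤ M) (hB : ∀ n < P, |iteratedDeriv n g a| ≤ B) (hx : p x ≤ M)
    (hy : p y ≤ M) :
    p (taylorSum g P a x - taylorSum g P a y) ≤ P * (B * (P * M ^ P * p (x - y))) := by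
  simp only [taylorSum, ← Finset.sum_sub_distrib, ← smul_sub]
  refine seminorm_sum_smul_le p (fun n hn => abs_div_factorial_le (hB n hn) n) fun n hn =>
    (hp.pow_sub_pow_le hM hx hy n).trans ?_
  have := apply_nonneg p (x - y)
  gcongr

theorem taylorSum_add_smul_one_sub_le (hg : ContDiff ℝ P g) {D : ℝ}
    (hB : ∀ x, |x| ≤ D → |iteratedDeriv P g x| ≤ B) (ha : |a| ≤ D) (hb : |b| ≤ D)
    (hx : p x ≤ M) (hab : |b - a| ≤ M) :
    p (taylorSum g P a (x + (b - a) • 1) - taylorSum g P b x) ≤ P * (B * M ^ P) := by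
  have hB0 : 0 ≤ B := (abs_nonneg _).trans (hB a ha)
  have hM0 : 0 ≤ M := (abs_nonneg _).trans hab
  have hcoeff (j : ℕ) (hj : j < P) :
      |taylorSum (iteratedDeriv j g) (P - j) a (b - a) - iteratedDeriv j g b| ≤
        B * M ^ (P - j) := by
    rw [abs_sub_comm]
    refine (abs_sub_taylorSum_le (D := D) (B := B) ?_ (fun x hx => ?_) ha hb).trans (by gcongr)
    · rw [iteratedDeriv_eq_iterate]
      exact ContDiff.iterate_deriv' (P - j) j (by rwa [Nat.sub_add_cancel hj.le])
    · rw [iteratedDeriv_iteratedDeriv, Nat.sub_add_cancel hj.le]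
      exact hB x hx
  rw [taylorSum_add_smul_one, taylorSum, ← Finset.sum_sub_distrib]
  refine (Finset.le_sum_of_subadditive p (map_zero p).le (map_add_le_add p) _ _).trans ?_
  refine (Finset.sum_le_card_nsmul _ _ (B * M ^ P) fun j hj => ?_).trans (by simp)
  have hj := Finset.mem_range.1 hj
  rw [← sub_smul, ← sub_div, map_smul_eq_mul, Real.norm_eq_abs]
  calc _ ≤ B * M ^ (P - j) * M ^ j :=
        mul_le_mul (abs_div_factorial_le (hcoeff j hj) j) (hp.pow_le hx j) (apply_nonneg _ _)
          (by positivity)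
    _ = B * M ^ P := by rw [mul_assoc, ← pow_add, Nat.sub_add_cancel hj.le]

end IsAlgSeminorm

end Seminorm

/-! ### Weighted `ℓ¹` seminorms on monoid algebras -/

section Weighted

variable {M : Type*}

/-- The weighted `ℓ¹` seminorm `∑ w(m) |x_m|` on a monoid algebra. -/
def weightSeminorm (w : M → NNReal) : Seminorm ℝ (AddMonoidAlgebra ℝ M) :=
  Seminorm.of (fun x => x.coeff.sum fun m c => |c| * w m)
    (fun x y => by
      classical
      have sum_eq (z : M →₀ ℝ) (hz : z.support ⊆ x.coeff.support ∪ y.coeff.support) :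
          (z.sum fun m c => |c| * w m) =
            ∑ m ∈ x.coeff.support ∪ y.coeff.support, |z m| * w m :=
        Finsupp.sum_of_support_subset _ hz _ (by simp)
      rw [AddMonoidAlgebra.coeff_add, sum_eq _ Finsupp.support_add,
        sum_eq _ Finset.subset_union_left, sum_eq _ Finset.subset_union_right,
        ← Finset.sum_add_distrib]
      refine Finset.sum_le_sum fun m _ => ?_
      rw [← add_mul, Finsupp.add_apply]
      gcongr
      exact abs_add_le _ _)
    (fun a x => by
      rw [AddMonoidAlgebra.coeff_smul, Finsupp.sum_of_support_subset _ Finsupp.support_smul _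
        (by simp), Finsupp.sum, Finset.mul_sum]
      simp [abs_mul, mul_assoc])

theorem weightSeminorm_apply (w : M → NNReal) (x : AddMonoidAlgebra ℝ M) :
    weightSeminorm w x = x.coeff.sum fun m c => |c| * w m := rfl

theorem weightSeminorm_single (w : M → NNReal) (m : M) (c : ℝ) :
    weightSeminorm w (AddMonoidAlgebra.single m c) = |c| * w m := by
  rw [weightSeminorm_apply, AddMonoidAlgebra.coeff_single, Finsupp.sum_single_index (by simp)]

theorem weightSeminorm_eq_sum {w : M → NNReal} {x : AddMonoidAlgebra ℝ M} {s : Finset M}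
    (hs : ∀ m ∉ s, x.coeff m = 0 ∨ w m = 0) :
    weightSeminorm w x = ∑ m ∈ s, |x.coeff m| * w m := by
  classical
  rw [weightSeminorm_apply, Finsupp.sum_of_support_subset (s := x.coeff.support ∪ s) _
    Finset.subset_union_left _ (by simp)]
  refine (Finset.sum_subset Finset.subset_union_right fun m _ hm => ?_).symm
  rcases hs m hm with h | h <;> simp [h]

theorem abs_coeff_mul_le_weightSeminorm (w : M → NNReal) (x : AddMonoidAlgebra ℝ M) (m : M) :
    |x.coeff m| * w m ≤ weightSeminorm w x := by
  rw [weightSeminorm_apply]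
  by_cases hm : m ∈ x.coeff.support
  · exact Finset.single_le_sum (f := fun m => |x.coeff m| * w m) (fun _ _ => by positivity) hm
  · rw [Finsupp.notMem_support_iff.1 hm, abs_zero, zero_mul]
    exact Finset.sum_nonneg fun _ _ => by positivity

theorem seminorm_linearMap_le_weightSeminorm {N : Type*} [AddCommGroup N] [Module ℝ N]
    {w : M → NNReal} (q : Seminorm ℝ N) (φ : AddMonoidAlgebra ℝ M →ₗ[ℝ] N)
    (x : AddMonoidAlgebra ℝ M) {C : ℝ}
    (h : ∀ m ∈ x.coeff.support, q (φ (AddMonoidAlgebra.single m 1)) ≤ C * w m) :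
    q (φ x) ≤ C * weightSeminorm w x := by
  have hx : x = ∑ m ∈ x.coeff.support, x.coeff m • AddMonoidAlgebra.single m (1 : ℝ) := by
    simpa [Finsupp.sum] using (AddMonoidAlgebra.sum_coeff_single x).symm
  conv_lhs => rw [hx, map_sum]
  refine (Finset.le_sum_of_subadditive q (map_zero q).le (map_add_le_add q) _ _).trans ?_
  rw [weightSeminorm_apply, Finsupp.sum, Finset.mul_sum]
  refine Finset.sum_le_sum fun m hm => ?_
  rw [map_smul, map_smul_eq_mul, Real.norm_eq_abs, mul_left_comm]
  exact mul_le_mul_of_nonneg_left (h m hm) (abs_nonneg _)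

theorem isAlgSeminorm_weightSeminorm [AddCommMonoid M] {w : M → NNReal} (h0 : w 0 ≤ 1)
    (hadd : ∀ m n, w (m + n) ≤ w m * w n) : IsAlgSeminorm (weightSeminorm w) where
  one_le := by
    rw [AddMonoidAlgebra.one_def, weightSeminorm_single, abs_one, one_mul]
    exact_mod_cast h0
  mul_le x y := by
    rw [mul_comm (weightSeminorm w x)]
    refine seminorm_linearMap_le_weightSeminorm _ (LinearMap.mulRight ℝ y) x fun m _ => ?_
    rw [LinearMap.mulRight_apply, mul_comm _ (w m : ℝ)]
    refine seminorm_linearMap_le_weightSeminorm _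
      (LinearMap.mulLeft ℝ (AddMonoidAlgebra.single m (1 : ℝ))) y fun n _ => ?_
    rw [LinearMap.mulLeft_apply, AddMonoidAlgebra.single_mul_single, weightSeminorm_single]
    simpa using mod_cast hadd m n

end Weighted

/-! ### The grading of the forest algebra by the number of vertices -/

section Forests

variable {d : ℕ}

theorem forestSize_zero : forestSize (0 : Forest d) = 0 := rfl

theorem forestSize_add (ζ ξ : Forest d) : forestSize (ζ + ξ) = forestSize ζ + forestSize ξ := by
  simp [forestSize]

theorem forestSize_singleton (τ : Tree d) : forestSize {τ} = τ.size := by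
  simp [forestSize]

theorem Tree.size_pos (τ : Tree d) : 0 < τ.size := by
  rw [← node_rootLabel_branches τ, size_node]
  exact Nat.succ_pos _

theorem Tree.size_le_forestSize {τ : Tree d} {ζ : Forest d} (h : τ ∈ ζ) :
    τ.size ≤ forestSize ζ :=
  Multiset.le_sum_of_mem (Multiset.mem_map_of_mem _ h)

theorem card_le_forestSize (ζ : Forest d) : Multiset.card ζ ≤ forestSize ζ := by
  have := Multiset.card_nsmul_le_sum (s := ζ.map Tree.size) (a := 1) fun n hn => by
    obtain ⟨τ, -, rfl⟩ := Multiset.mem_map.1 hn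
    exact τ.size_pos
  simpa [forestSize] using this

theorem forestSize_eq_zero {ζ : Forest d} : forestSize ζ = 0 ↔ ζ = 0 :=
  ⟨fun h => Multiset.card_eq_zero.1 (Nat.le_zero.1 (h ▸ card_le_forestSize ζ)),
    fun h => h ▸ forestSize_zero⟩

theorem finite_forestSize_lt (n : ℕ) : {ζ : Forest d | forestSize ζ < n}.Finite := by
  classical
  induction n with
  | zero => simp
  | succ n ih =>
    have htree : {τ : Tree d | τ.size < n + 1}.Finite := by
      refine ((Set.finite_univ (α := Fin d)).prod ih |>.image fun p => node p.1 p.2).subset ?_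
      intro τ (hτ : τ.size < n + 1)
      refine ⟨(rootLabel τ, branches τ), ⟨Set.mem_univ _, ?_⟩, node_rootLabel_branches τ⟩
      rw [← node_rootLabel_branches τ, size_node] at hτ
      simpa using hτ
    refine (Set.finite_Iic (n • htree.toFinset.val)).subset fun ζ (hζ : forestSize ζ < n + 1) => ?_
    rw [Set.mem_Iic, Multiset.le_iff_count]
    intro τ
    by_cases hτ : τ ∈ ζ
    · have hmem : τ ∈ htree.toFinset :=
        htree.mem_toFinset.2 ((Tree.size_le_forestSize hτ).trans_lt hζ)
      rw [Multiset.count_nsmul, Multiset.count_eq_one_of_mem htree.toFinset.nodup hmem]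
      have := (Multiset.count_le_card τ ζ).trans (card_le_forestSize ζ)
      lia
    · rw [Multiset.count_eq_zero_of_notMem hτ]
      exact Nat.zero_le _

/-- The finite set of forests with less than `n` vertices. -/
def smallForests (d n : ℕ) : Finset (Forest d) :=
  (finite_forestSize_lt (d := d) n).toFinset

theorem mem_smallForests {n : ℕ} {ζ : Forest d} : ζ ∈ smallForests d n ↔ forestSize ζ < n := by
  simp [smallForests]

theorem ofForest_zero : ofForest (0 : Forest d) = 1 := rfl

theorem ofForest_add (ζ ξ : Forest d) : ofForest (ζ + ξ) = ofForest ζ * ofForest ξ := by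
  simp [ofForest, AddMonoidAlgebra.single_mul_single]

theorem forestAlg_hom_ext {N : Type*} [AddCommGroup N] [Module ℝ N] {φ ψ : ForestAlg d →ₗ[ℝ] N}
    (h : ∀ ζ, φ (ofForest ζ) = ψ (ofForest ζ)) : φ = ψ :=
  AddMonoidAlgebra.lhom_ext' fun ζ => LinearMap.ext_ring (h ζ)

/-- The linear combinations of forests whose number of vertices lies in `s`. -/
def sizeSupported (d : ℕ) (s : Set ℕ) : Submodule ℝ (ForestAlg d) :=
  AddMonoidAlgebra.supported ℝ ℝ (forestSize ⁻¹' s)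

variable {s t u : Set ℕ} {x y : ForestAlg d}

theorem mem_sizeSupported : x ∈ sizeSupported d s ↔ ∀ ζ, forestSize ζ ∉ s → x.coeff ζ = 0 :=
  AddMonoidAlgebra.mem_supported'

theorem sizeSupported_mono (h : s ⊆ t) : sizeSupported d s ≤ sizeSupported d t :=
  AddMonoidAlgebra.supported_mono (Set.preimage_mono h)

theorem ofForest_mem_sizeSupported {ζ : Forest d} (h : forestSize ζ ∈ s) :
    ofForest ζ ∈ sizeSupported d s := by
  refine mem_sizeSupported.2 fun ξ hξ => ?_
  rw [ofForest, AddMonoidAlgebra.coeff_single, Finsupp.single_apply_eq_zero]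
  rintro rfl
  exact absurd h hξ

theorem one_mem_sizeSupported (h : 0 ∈ s) : (1 : ForestAlg d) ∈ sizeSupported d s :=
  ofForest_mem_sizeSupported (ζ := 0) h

theorem map_mem_of_mem_sizeSupported {N : Type*} [AddCommGroup N] [Module ℝ N] {V : Submodule ℝ N}
    {φ : ForestAlg d →ₗ[ℝ] N} (h : ∀ ζ, forestSize ζ ∈ s → φ (ofForest ζ) ∈ V)
    (hx : x ∈ sizeSupported d s) : φ x ∈ V := by
  suffices sizeSupported d s ≤ V.comap φ from this hx
  rw [sizeSupported, AddMonoidAlgebra.supported_eq_span_single, Submodule.span_le]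
  rintro _ ⟨ζ, hζ, rfl⟩
  exact h ζ hζ

theorem mul_mem_sizeSupported (h : ∀ m ∈ s, ∀ n ∈ t, m + n ∈ u) (hx : x ∈ sizeSupported d s)
    (hy : y ∈ sizeSupported d t) : x * y ∈ sizeSupported d u := by
  refine map_mem_of_mem_sizeSupported (φ := LinearMap.mulRight ℝ y) (fun ζ hζ => ?_) hx
  refine map_mem_of_mem_sizeSupported (φ := LinearMap.mulLeft ℝ (ofForest ζ)) (fun ξ hξ => ?_) hy
  rw [LinearMap.mulLeft_apply, ← ofForest_add]
  exact ofForest_mem_sizeSupported (by rw [forestSize_add]; exact h _ hζ _ hξ)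

theorem pow_mem_sizeSupported_Ici {m : ℕ} (hx : x ∈ sizeSupported d (Set.Ici m)) (n : ℕ) :
    x ^ n ∈ sizeSupported d (Set.Ici (n * m)) := by
  induction n with
  | zero => exact one_mem_sizeSupported (by simp)
  | succ n ih =>
    rw [pow_succ, add_one_mul]
    exact mul_mem_sizeSupported (fun _ ha _ hb => Set.mem_Ici.2 (Nat.add_le_add ha hb)) ih hx

theorem pow_mem_sizeSupported_Iic {m : ℕ} (hx : x ∈ sizeSupported d (Set.Iic m)) (n : ℕ) :
    x ^ n ∈ sizeSupported d (Set.Iic (n * m)) := by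
  induction n with
  | zero => exact one_mem_sizeSupported (by simp)
  | succ n ih =>
    rw [pow_succ, add_one_mul]
    exact mul_mem_sizeSupported (fun _ ha _ hb => Set.mem_Iic.2 (Nat.add_le_add ha hb)) ih hx

theorem taylorSum_mem_sizeSupported_Iic {m : ℕ} (hx : x ∈ sizeSupported d (Set.Iic m))
    (g : ℝ → ℝ) (P : ℕ) (a : ℝ) : taylorSum g P a x ∈ sizeSupported d (Set.Iic (P * m)) :=
  Submodule.sum_mem _ fun n hn => Submodule.smul_mem _ _ <|
    sizeSupported_mono (Set.Iic_subset_Iic.2 (Nat.mul_le_mul_right m (Finset.mem_range.1 hn).le))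
      (pow_mem_sizeSupported_Iic hx n)

theorem mul_sub_mul_mem_sizeSupported_Iio {m n : ℕ} {x' y' : ForestAlg d}
    (hx : x ∈ sizeSupported d (Set.Iic m)) (hy : y ∈ sizeSupported d (Set.Iic n))
    (hxx' : x' - x ∈ sizeSupported d (Set.Iio m)) (hyy' : y' - y ∈ sizeSupported d (Set.Iio n)) :
    x' * y' - x * y ∈ sizeSupported d (Set.Iio (m + n)) := by
  have hy' : y' ∈ sizeSupported d (Set.Iic n) := by
    simpa using Submodule.add_mem _ (sizeSupported_mono Set.Iio_subset_Iic_self hyy') hy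
  have hsplit : x' * y' - x * y = (x' - x) * y' + x * (y' - y) := by ring
  rw [hsplit]
  exact Submodule.add_mem _
    (mul_mem_sizeSupported
      (fun _ ha _ hb => Set.mem_Iio.2 (Nat.add_lt_add_of_lt_of_le ha hb)) hxx' hy')
    (mul_mem_sizeSupported
      (fun _ ha _ hb => Set.mem_Iio.2 (Nat.add_lt_add_of_le_of_lt ha hb)) hx hyy')

end Forests

/-! ### The action of characters on the forest algebra -/

section CharAction

variable {d : ℕ} (g : ForestAlg d →ₐ[ℝ] ℝ)

/-- The contraction `g ⊗ id` of the left tensor factor. -/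
def contract (N : Type*) [AddCommGroup N] [Module ℝ N] : ForestAlg d ⊗[ℝ] N →ₗ[ℝ] N :=
  (TensorProduct.lid ℝ N).toLinearMap ∘ₗ g.toLinearMap.rTensor N

theorem contract_tmul {N : Type*} [AddCommGroup N] [Module ℝ N] (x : ForestAlg d) (y : N) :
    contract g N (x ⊗ₜ y) = g x • y := by
  simp [contract]

theorem contract_lTensor {N N' : Type*} [AddCommGroup N] [Module ℝ N] [AddCommGroup N']
    [Module ℝ N'] (φ : N →ₗ[ℝ] N') (x : ForestAlg d ⊗[ℝ] N) :
    contract g N' (φ.lTensor (ForestAlg d) x) = φ (contract g N x) := by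
  induction x using TensorProduct.induction_on with
  | zero => simp
  | tmul x y => simp [contract_tmul]
  | add x y hx hy => simp only [map_add, hx, hy]

theorem structAction_apply (y : ModelSpace d) :
    structAction g y = contract g _ (coaction y) := rfl

/-- The algebra morphism `(g ⊗ id) Δ` of the forest algebra. -/
def charAction : ForestAlg d →ₐ[ℝ] ForestAlg d :=
  (Algebra.TensorProduct.lift ((Algebra.ofId ℝ (ForestAlg d)).comp g)
    (AlgHom.id ℝ (ForestAlg d)) fun _ _ => Commute.all _ _).comp coprod

theorem charAction_apply (x : ForestAlg d) : charAction g x = contract g _ (coprod x) := by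
  rw [charAction, AlgHom.comp_apply]
  induction coprod x using TensorProduct.induction_on with
  | zero => simp
  | tmul x y =>
    rw [contract_tmul, Algebra.TensorProduct.lift_tmul]
    simp [Algebra.ofId_apply, Algebra.smul_def]
  | add x y hx hy => simp only [map_add, hx, hy]

theorem mulXi_ofForest (i : Fin d) (ζ : Forest d) :
    mulXi i (ofForest ζ) = Finsupp.single (.noise ζ i) 1 :=
  linExt_ofForest _ ζ

theorem graft_ofForest (i : Fin d) (ζ : Forest d) : graft i (ofForest ζ) = ofForest {node i ζ} :=
  linExt_ofForest _ ζ

theorem toForestAlg_unit : toForestAlg (Finsupp.single (.unit : Sym d) 1) = 1 := by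
  simp [toForestAlg]

theorem toForestAlg_tree (τ : Tree d) :
    toForestAlg (Finsupp.single (.tree τ) 1) = ofForest {τ} := by
  simp [toForestAlg]

theorem toForestAlg_noise (ζ : Forest d) (i : Fin d) :
    toForestAlg (Finsupp.single (.noise ζ i) 1) = 0 := by
  simp [toForestAlg]

theorem toForestAlg_mulXi (i : Fin d) (x : ForestAlg d) : toForestAlg (mulXi i x) = 0 := by
  suffices h : toForestAlg ∘ₗ mulXi i = 0 from LinearMap.congr_fun h x
  exact forestAlg_hom_ext fun ζ => by simp [mulXi_ofForest, toForestAlg_noise]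

theorem structAction_mulXi (i : Fin d) (x : ForestAlg d) :
    structAction g (mulXi i x) = mulXi i (charAction g x) := by
  suffices h : structAction g ∘ₗ mulXi i = mulXi i ∘ₗ (charAction g).toLinearMap from
    LinearMap.congr_fun h x
  refine forestAlg_hom_ext fun ζ => ?_
  have hcoaction : coaction (Finsupp.single (.noise ζ i) 1) =
      (mulXi i).lTensor (ForestAlg d) (coprod (ofForest ζ)) := by
    simp [coaction]
  rw [LinearMap.comp_apply, LinearMap.comp_apply, AlgHom.toLinearMap_apply, charAction_apply,
    ← contract_lTensor, structAction_apply, mulXi_ofForest, hcoaction]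

theorem toForestAlg_structAction (y : ModelSpace d) :
    toForestAlg (structAction g y) = charAction g (toForestAlg y) := by
  suffices h : toForestAlg ∘ₗ structAction g = (charAction g).toLinearMap ∘ₗ toForestAlg from
    LinearMap.congr_fun h y
  refine Finsupp.lhom_ext' fun σ => LinearMap.ext_ring ?_
  simp only [LinearMap.comp_apply, AlgHom.toLinearMap_apply, Finsupp.lsingle_apply]
  rcases σ with _ | τ | ⟨ζ, i⟩
  · have hcoaction : coaction (Finsupp.single (.unit : Sym d) 1) =
        1 ⊗ₜ[ℝ] Finsupp.single .unit 1 := by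
      simp [coaction]
    rw [structAction_apply, hcoaction, contract_tmul, map_one, one_smul, toForestAlg_unit, map_one]
  · rw [structAction_apply, ← contract_lTensor, toForestAlg_coaction_tree, toForestAlg_tree,
      charAction_apply]
  · rw [← mulXi_ofForest, structAction_mulXi, toForestAlg_mulXi, toForestAlg_mulXi, map_zero]

theorem charAction_graft (i : Fin d) (x : ForestAlg d) :
    charAction g (graft i x) = g (graft i x) • 1 + graft i (charAction g x) := by
  suffices h : (charAction g).toLinearMap ∘ₗ graft i =
      (g.toLinearMap ∘ₗ graft i).smulRight 1 + graft i ∘ₗ (charAction g).toLinearMap from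
    LinearMap.congr_fun h x
  refine forestAlg_hom_ext fun ζ => ?_
  have hcoprod : coprod (graft i (ofForest ζ)) = coprodTree (node i ζ) := by
    rw [graft_ofForest, coprod_ofForest, Multiset.map_singleton, Multiset.prod_singleton]
  simp only [LinearMap.comp_apply, LinearMap.add_apply, LinearMap.smulRight_apply,
    AlgHom.toLinearMap_apply]
  rw [charAction_apply, hcoprod, coprodTree_node, map_add, contract_tmul, contract_lTensor,
    ← charAction_apply, graft_ofForest]

theorem graft_mem_sizeSupported_Iio {n : ℕ} (i : Fin d) {x : ForestAlg d}
    (hx : x ∈ sizeSupported d (Set.Iio n)) : graft i x ∈ sizeSupported d (Set.Iio (n + 1)) := by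
  refine map_mem_of_mem_sizeSupported (fun ζ hζ => ?_) hx
  rw [graft_ofForest]
  refine ofForest_mem_sizeSupported ?_
  rw [forestSize_singleton, size_node]
  exact Nat.add_lt_add_right hζ 1

theorem charAction_ofForest_sub_mem_of_trees {ζ : Forest d}
    (h : ∀ τ ∈ ζ, charAction g (ofForest {τ}) - ofForest {τ} ∈ sizeSupported d (Set.Iio τ.size)) :
    charAction g (ofForest ζ) - ofForest ζ ∈ sizeSupported d (Set.Iio (forestSize ζ)) := by
  induction ζ using Multiset.induction with
  | empty => simp [ofForest_zero]
  | cons τ ζ ih =>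
    rw [← Multiset.singleton_add, ofForest_add, map_mul, forestSize_add, forestSize_singleton]
    exact mul_sub_mul_mem_sizeSupported_Iio
      (ofForest_mem_sizeSupported (forestSize_singleton τ).le)
        (ofForest_mem_sizeSupported Set.self_mem_Iic)
      (h τ (Multiset.mem_cons_self τ ζ)) (ih fun σ hσ => h σ (Multiset.mem_cons_of_mem hσ))

theorem charAction_ofForest_sub_mem (ζ : Forest d) :
    charAction g (ofForest ζ) - ofForest ζ ∈ sizeSupported d (Set.Iio (forestSize ζ)) := by
  suffices htree : ∀ τ : Tree d,
      charAction g (ofForest {τ}) - ofForest {τ} ∈ sizeSupported d (Set.Iio τ.size) from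
    charAction_ofForest_sub_mem_of_trees g fun τ _ => htree τ
  intro τ
  induction τ using Tree.induction with
  | h i ξ ih =>
    rw [← graft_ofForest, charAction_graft, add_sub_assoc, ← map_sub, size_node]
    exact Submodule.add_mem _
      (Submodule.smul_mem _ _ (one_mem_sizeSupported (Set.mem_Iio.2 (Nat.succ_pos _))))
      (graft_mem_sizeSupported_Iio i (charAction_ofForest_sub_mem_of_trees g ih))

theorem coeff_charAction_ofForest {ζ ξ : Forest d} (h : forestSize ζ ≤ forestSize ξ) :
    (charAction g (ofForest ζ)).coeff ξ = (ofForest ζ).coeff ξ := by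
  have := mem_sizeSupported.1 (charAction_ofForest_sub_mem g ζ) ξ (not_lt.2 h)
  rwa [AddMonoidAlgebra.coeff_sub, Finsupp.sub_apply, sub_eq_zero] at this

end CharAction

/-! ### Coordinates -/

section Coordinates

variable {d : ℕ}

/-- The linear functional reading off the coefficient of the forest `ζ`. -/
def coeffFunctional (ζ : Forest d) : ForestAlg d →ₗ[ℝ] ℝ :=
  Finsupp.lapply ζ ∘ₗ (AddMonoidAlgebra.coeffLinearEquiv ℝ).toLinearMap

theorem coeffFunctional_apply (ζ : Forest d) (x : ForestAlg d) :
    coeffFunctional ζ x = x.coeff ζ := rfl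

theorem mulXi_eq_mapDomain (i : Fin d) (x : ForestAlg d) :
    mulXi i x = x.coeff.mapDomain (Sym.noise · i) := by
  simp [mulXi, linExt, Finsupp.linearCombination_apply, Finsupp.mapDomain]

theorem mulXi_noise (i : Fin d) (x : ForestAlg d) (ζ : Forest d) :
    mulXi i x (.noise ζ i) = x.coeff ζ := by
  rw [mulXi_eq_mapDomain]
  exact Finsupp.mapDomain_apply (fun _ _ h => (Sym.noise.inj h).1) _ _

theorem mulXi_eq_zero (i : Fin d) (x : ForestAlg d) {σ : Sym d} (h : ∀ ζ, σ ≠ .noise ζ i) :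
    mulXi i x σ = 0 := by
  rw [mulXi_eq_mapDomain]
  exact Finsupp.mapDomain_of_notMem_range _ _ fun ⟨ζ, hζ⟩ => h ζ hζ.symm

theorem coeff_toForestAlg_zero (y : ModelSpace d) : (toForestAlg y).coeff 0 = y .unit := by
  suffices h : coeffFunctional 0 ∘ₗ toForestAlg = Finsupp.lapply (.unit : Sym d) from
    LinearMap.congr_fun h y
  refine Finsupp.lhom_ext' fun σ => LinearMap.ext_ring ?_
  rcases σ with _ | τ | ⟨ζ, i⟩ <;> simp [coeffFunctional, toForestAlg, ofForest]

theorem coeff_toForestAlg_singleton (y : ModelSpace d) (τ : Tree d) :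
    (toForestAlg y).coeff {τ} = y (.tree τ) := by
  classical
  suffices h : coeffFunctional {τ} ∘ₗ toForestAlg = Finsupp.lapply (.tree τ) from
    LinearMap.congr_fun h y
  refine Finsupp.lhom_ext' fun σ => LinearMap.ext_ring ?_
  rcases σ with _ | τ' | ⟨ζ, i⟩ <;>
    simp [coeffFunctional, toForestAlg, ofForest, Finsupp.single_apply, AddMonoidAlgebra.one_def]

theorem coeff_toForestAlg_eq_zero (y : ModelSpace d) {ξ : Forest d} (h0 : ξ ≠ 0)
    (h1 : ∀ τ, ξ ≠ {τ}) : (toForestAlg y).coeff ξ = 0 := by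
  suffices h : coeffFunctional ξ ∘ₗ toForestAlg = 0 from LinearMap.congr_fun h y
  refine Finsupp.lhom_ext' fun σ => LinearMap.ext_ring ?_
  rcases σ with _ | τ | ⟨ζ, i⟩ <;>
    simp [coeffFunctional, toForestAlg, ofForest, AddMonoidAlgebra.one_def, h0.symm, (h1 _).symm]

theorem coeff_toForestAlg_cases (γ : ℝ) (y : ModelSpace d) (ζ : Forest d) :
    (toForestAlg y).coeff ζ = 0 ∨
      ∃ σ, homogeneity γ σ = γ * forestSize ζ ∧ (toForestAlg y).coeff ζ = y σ := by
  by_cases hzero : ζ = 0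
  · subst hzero
    exact Or.inr ⟨.unit, by simp [homogeneity, forestSize_zero], coeff_toForestAlg_zero y⟩
  · by_cases htree : ∃ τ, ζ = {τ}
    · obtain ⟨τ, rfl⟩ := htree
      exact Or.inr ⟨.tree τ, by rw [homogeneity, forestSize_singleton],
        coeff_toForestAlg_singleton y τ⟩
    · exact Or.inl (coeff_toForestAlg_eq_zero y hzero fun τ hτ => htree ⟨τ, hτ⟩)

end Coordinates

/-! ### The norms of modelled distributions -/

section Norms

variable {S : Type} {deg : S → ℝ}

open scoped Classical in
theorem projHomog_apply (β : ℝ) (x : S →₀ ℝ) (σ : S) :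
    projHomog deg β x σ = if deg σ = β then x σ else 0 :=
  Finsupp.filter_apply ..

theorem homNorm_eq_norm {β : ℝ} {x : S →₀ ℝ} {s : Finset S}
    (hs : (projHomog deg β x).support ⊆ s) :
    homNorm deg β x =
      ‖(WithLp.toLp 2 fun σ : s => projHomog deg β x σ : EuclideanSpace ℝ s)‖ := by
  rw [homNorm, Finsupp.sum_of_support_subset _ hs _ (by simp), EuclideanSpace.norm_eq,
    ← Finset.sum_coe_sort]
  simp

theorem homNorm_nonneg (β : ℝ) (x : S →₀ ℝ) : 0 ≤ homNorm deg β x := Real.sqrt_nonneg _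

theorem homNorm_zero (β : ℝ) : homNorm deg β 0 = 0 := by
  simp [homNorm, projHomog, Finsupp.filter_zero]

theorem homNorm_neg (β : ℝ) (x : S →₀ ℝ) : homNorm deg β (-x) = homNorm deg β x := by
  rw [homNorm, homNorm, projHomog, Finsupp.filter_neg, Finsupp.sum_neg_index (by simp), projHomog]
  simp

theorem homNorm_add_le (β : ℝ) (x y : S →₀ ℝ) :
    homNorm deg β (x + y) ≤ homNorm deg β x + homNorm deg β y := by
  classical
  have h_add : projHomog deg β (x + y) = projHomog deg β x + projHomog deg β y :=
    Finsupp.filter_add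
  have h_supp : (projHomog deg β (x + y)).support ⊆
      (projHomog deg β x).support ∪ (projHomog deg β y).support := h_add ▸ Finsupp.support_add
  rw [homNorm_eq_norm h_supp, homNorm_eq_norm Finset.subset_union_left,
    homNorm_eq_norm Finset.subset_union_right]
  refine (le_of_eq ?_).trans (norm_add_le _ _)
  congr 1
  ext σ
  simp [h_add]

theorem abs_apply_le_homNorm (x : S →₀ ℝ) (σ : S) : |x σ| ≤ homNorm deg (deg σ) x := by
  classical
  rw [homNorm_eq_norm (Finset.subset_insert σ _)]
  simpa [projHomog_apply] using PiLp.norm_apply_le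
    (WithLp.toLp 2 fun τ : (insert σ (projHomog deg (deg σ) x).support : Finset S) =>
      projHomog deg (deg σ) x τ : EuclideanSpace ℝ _) ⟨σ, Finset.mem_insert_self _ _⟩

theorem homNorm_le_sum_abs {β : ℝ} {x : S →₀ ℝ} {s : Finset S}
    (hs : (projHomog deg β x).support ⊆ s) :
    homNorm deg β x ≤ ∑ σ ∈ s, |projHomog deg β x σ| := by
  rw [homNorm, Finsupp.sum_of_support_subset _ hs _ (by simp)]
  refine Real.sqrt_le_iff.2 ⟨Finset.sum_nonneg fun _ _ => abs_nonneg _, ?_⟩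
  simpa only [sq_abs] using Finset.sum_sq_le_sq_sum_of_nonneg
    (f := fun σ => |projHomog deg β x σ|) (s := s) fun _ _ => abs_nonneg _

theorem homNorm_le_card_mul {β : ℝ} {x : S →₀ ℝ} (s : Finset S) {c : ℝ} (hc : 0 ≤ c)
    (hs : ∀ σ, deg σ = β → x σ ≠ 0 → σ ∈ s) (h : ∀ σ, deg σ = β → |x σ| ≤ c) :
    homNorm deg β x ≤ s.card * c := by
  classical
  have h_supp : (projHomog deg β x).support ⊆ s := fun σ hσ => by
    rw [Finsupp.mem_support_iff, projHomog_apply, ne_eq, ite_eq_right_iff, not_forall] at hσ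
    exact hs σ hσ.choose hσ.choose_spec
  have h_le : ∀ σ ∈ s, |projHomog deg β x σ| ≤ c := fun σ _ => by
    rw [projHomog_apply]
    split_ifs with hσ
    · exact h σ hσ
    · rwa [abs_zero]
  simpa only [nsmul_eq_mul] using
    (homNorm_le_sum_abs h_supp).trans (Finset.sum_le_card_nsmul s _ c h_le)

variable {Γ : ℝ → ℝ → ((S →₀ ℝ) →ₗ[ℝ] (S →₀ ℝ))} {η : ℝ} {K : Set ℝ}

/-- The first summand of `|||F|||_{η,K}`: the supremum of the norms of the values of `F`. -/
def mdSup (deg : S → ℝ) (η : ℝ) (K : Set ℝ) (F : ℝ → (S →₀ ℝ)) : ℝ≥0∞ :=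
  ⨆ x ∈ K, ⨆ β ∈ indexSet deg ∩ Set.Iio η, ENNReal.ofReal (homNorm deg β (F x))

/-- The second summand of `|||F|||_{η,K}`: the Hölder seminorm of the increments of `F`. -/
def mdHolder (deg : S → ℝ) (Γ : ℝ → ℝ → ((S →₀ ℝ) →ₗ[ℝ] (S →₀ ℝ))) (η : ℝ) (K : Set ℝ)
    (F : ℝ → (S →₀ ℝ)) : ℝ≥0∞ :=
  ⨆ x ∈ K, ⨆ y ∈ K, ⨆ (_ : 0 < dist x y ∧ dist x y ≤ 1), ⨆ β ∈ indexSet deg ∩ Set.Iio η,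
    ENNReal.ofReal (homNorm deg β (F x - Γ x y (F y)) / dist x y ^ (η - β))

theorem mdNorm_eq_mdSup_add_mdHolder (F : ℝ → (S →₀ ℝ)) :
    mdNorm deg Γ η K F = mdSup deg η K F + mdHolder deg Γ η K F :=
  rfl

theorem mdSup_le_iff {F : ℝ → (S →₀ ℝ)} {c : ℝ≥0∞} :
    mdSup deg η K F ≤ c ↔ ∀ x ∈ K, ∀ β ∈ indexSet deg, β < η →
      ENNReal.ofReal (homNorm deg β (F x)) ≤ c := by
  simp only [mdSup, iSup_le_iff, Set.mem_inter_iff, Set.mem_Iio, and_imp]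

theorem mdHolder_le_iff {F : ℝ → (S →₀ ℝ)} {c : ℝ≥0∞} :
    mdHolder deg Γ η K F ≤ c ↔
      ∀ x ∈ K, ∀ y ∈ K, 0 < dist x y → dist x y ≤ 1 → ∀ β ∈ indexSet deg, β < η →
        ENNReal.ofReal (homNorm deg β (F x - Γ x y (F y)) / dist x y ^ (η - β)) ≤ c := by
  simp only [mdHolder, iSup_le_iff, Set.mem_inter_iff, Set.mem_Iio, and_imp]

theorem mdSup_add_le (F G : ℝ → (S →₀ ℝ)) :
    mdSup deg η K (fun t => F t + G t) ≤ mdSup deg η K F + mdSup deg η K G :=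
  mdSup_le_iff.2 fun x hx β hβ hβη =>
    ((ENNReal.ofReal_le_ofReal (homNorm_add_le β _ _)).trans ENNReal.ofReal_add_le).trans
      (add_le_add (mdSup_le_iff.1 le_rfl x hx β hβ hβη) (mdSup_le_iff.1 le_rfl x hx β hβ hβη))

theorem mdHolder_add_le (F G : ℝ → (S →₀ ℝ)) :
    mdHolder deg Γ η K (fun t => F t + G t) ≤ mdHolder deg Γ η K F + mdHolder deg Γ η K G := by
  refine mdHolder_le_iff.2 fun x hx y hy h0 h1 β hβ hβη => ?_
  have h_split : F x + G x - Γ x y (F y + G y) = (F x - Γ x y (F y)) + (G x - Γ x y (G y)) := by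
    rw [map_add, add_sub_add_comm]
  have h_le : homNorm deg β (F x + G x - Γ x y (F y + G y)) / dist x y ^ (η - β) ≤
      homNorm deg β (F x - Γ x y (F y)) / dist x y ^ (η - β) +
        homNorm deg β (G x - Γ x y (G y)) / dist x y ^ (η - β) := by
    rw [← add_div, h_split]
    gcongr
    exact homNorm_add_le β _ _
  exact ((ENNReal.ofReal_le_ofReal h_le).trans ENNReal.ofReal_add_le).trans
    (add_le_add (mdHolder_le_iff.1 le_rfl x hx y hy h0 h1 β hβ hβη)
      (mdHolder_le_iff.1 le_rfl x hx y hy h0 h1 β hβ hβη))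

theorem homNorm_le_of_mdNorm_le {F : ℝ → (S →₀ ℝ)} {c : ℝ} (hc : 0 ≤ c)
    (h : mdNorm deg Γ η K F ≤ ENNReal.ofReal c) {x : ℝ} (hx : x ∈ K) {β : ℝ}
    (hβ : β ∈ indexSet deg) (hβη : β < η) : homNorm deg β (F x) ≤ c :=
  (ENNReal.ofReal_le_ofReal_iff hc).1
    (mdSup_le_iff.1 (le_self_add.trans h) x hx β hβ hβη)

theorem homNorm_sub_le_of_mdNorm_le {F : ℝ → (S →₀ ℝ)} {c : ℝ} (hc : 0 ≤ c)
    (h : mdNorm deg Γ η K F ≤ ENNReal.ofReal c) {x y : ℝ} (hx : x ∈ K) (hy : y ∈ K)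
    (h0 : 0 < dist x y) (h1 : dist x y ≤ 1) {β : ℝ} (hβ : β ∈ indexSet deg) (hβη : β < η) :
    homNorm deg β (F x - Γ x y (F y)) ≤ c * dist x y ^ (η - β) := by
  rw [← div_le_iff₀ (Real.rpow_pos_of_pos h0 _), ← ENNReal.ofReal_le_ofReal_iff hc]
  exact mdHolder_le_iff.1 (le_add_self.trans h) x hx y hy h0 h1 β hβ hβη

theorem mdNorm_add_le (F G : ℝ → (S →₀ ℝ)) :
    mdNorm deg Γ η K (fun t => F t + G t) ≤ mdNorm deg Γ η K F + mdNorm deg Γ η K G := by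
  simp only [mdNorm_eq_mdSup_add_mdHolder]
  exact (add_le_add (mdSup_add_le F G) (mdHolder_add_le F G)).trans (add_add_add_comm ..).le

theorem mdNorm_neg (F : ℝ → (S →₀ ℝ)) :
    mdNorm deg Γ η K (fun t => -F t) = mdNorm deg Γ η K F := by
  have h : ∀ x y, -F x - Γ x y (-F y) = -(F x - Γ x y (F y)) := fun x y => by
    rw [map_neg, neg_sub_neg, neg_sub]
  simp only [mdNorm, h, homNorm_neg]

theorem mdNorm_zero : mdNorm deg Γ η K (fun _ => 0) = 0 := by
  simp [mdNorm, homNorm_zero]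

theorem mdNorm_sub_le (F G : ℝ → (S →₀ ℝ)) :
    mdNorm deg Γ η K (fun t => F t - G t) ≤ mdNorm deg Γ η K F + mdNorm deg Γ η K G := by
  simpa only [sub_eq_add_neg, mdNorm_neg] using
    mdNorm_add_le (deg := deg) (Γ := Γ) (η := η) (K := K) F fun t => -G t

theorem mdNorm_sub_le_add (F G H : ℝ → (S →₀ ℝ)) :
    mdNorm deg Γ η K (fun t => F t - H t) ≤
      mdNorm deg Γ η K (fun t => F t - G t) + mdNorm deg Γ η K (fun t => G t - H t) := by
  simpa only [sub_add_sub_cancel] using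
    mdNorm_add_le (deg := deg) (Γ := Γ) (η := η) (K := K) (fun t => F t - G t) fun t => G t - H t

theorem setOf_mdNorm_sub_lt_mem_nhds {V : Submodule ℝ (S →₀ ℝ)} (hK : IsCompact K)
    (Y : ModelledDistribution deg Γ V η) {ε : ℝ≥0∞} (hε : 0 < ε) :
    {Z : ModelledDistribution deg Γ V η | mdNorm deg Γ η K (fun t => Z t - Y t) < ε} ∈ nhds Y := by
  have h_open : IsOpen {Z : ModelledDistribution deg Γ V η |
      mdNorm deg Γ η K (fun t => Z t - Y t) < ε} :=
    TopologicalSpace.isOpen_generateFrom_of_mem ⟨K, Y, ε, hK, hε, rfl⟩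
  refine h_open.mem_nhds ?_
  simpa only [Set.mem_ofPred_eq, sub_self, mdNorm_zero] using hε

theorem continuous_of_locally_lipschitz {deg' : S → ℝ} {V W : Submodule ℝ (S →₀ ℝ)} {η' : ℝ}
    {Γ' : ℝ → ℝ → ((S →₀ ℝ) →ₗ[ℝ] (S →₀ ℝ))}
    (Φ : ModelledDistribution deg Γ V η → ModelledDistribution deg' Γ' W η')
    (h : ∀ K : Set ℝ, IsCompact K → ∀ D : ℝ, 0 < D → ∃ C : ℝ,
      ∀ F G : ModelledDistribution deg Γ V η,
      mdNorm deg Γ η K F + mdNorm deg Γ η K G ≤ ENNReal.ofReal D →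
        mdNorm deg' Γ' η' K (fun t => Φ F t - Φ G t) ≤
          ENNReal.ofReal C * mdNorm deg Γ η K (fun t => F t - G t)) : Continuous Φ := by
  refine continuous_generateFrom_iff.2 ?_
  rintro U ⟨K, F₀, ε, hK, -, rfl⟩
  refine isOpen_iff_mem_nhds.2 fun Y hY => ?_
  obtain ⟨δ, hδ, hδε⟩ :
      ∃ δ, mdNorm deg' Γ' η' K (fun t => Φ Y t - F₀ t) < δ ∧ δ < ε := exists_between hY
  set m := mdNorm deg Γ η K Y
  have hm : m ≠ ⊤ := (Y.finite K hK).ne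
  obtain ⟨C, hC⟩ := h K hK (1 + m + m).toReal (ENNReal.toReal_pos (by simp) (by simp [hm]))
  rw [ENNReal.ofReal_toReal (by simp [hm])] at hC
  set e := (δ - mdNorm deg' Γ' η' K fun t => Φ Y t - F₀ t) / (ENNReal.ofReal C + 1)
  have he : 0 < e := ENNReal.div_pos (tsub_pos_of_lt hδ).ne' (by simp)
  filter_upwards [setOf_mdNorm_sub_lt_mem_nhds hK Y (lt_min one_pos he)] with Z hZ
  have hZ_norm : mdNorm deg Γ η K Z ≤ 1 + m := by
    simpa only [sub_zero] using
      (mdNorm_sub_le_add (deg := deg) (Γ := Γ) (η := η) (K := K) Z Y fun _ => 0).trans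
        (add_le_add (hZ.le.trans (min_le_left 1 e)) (by simp only [sub_zero]; exact le_rfl))
  have hΦ : mdNorm deg' Γ' η' K (fun t => Φ Z t - Φ Y t) ≤
      δ - mdNorm deg' Γ' η' K (fun t => Φ Y t - F₀ t) :=
    calc _ ≤ ENNReal.ofReal C * mdNorm deg Γ η K (fun t => Z t - Y t) :=
          hC Z Y (add_le_add hZ_norm le_rfl)
      _ ≤ (ENNReal.ofReal C + 1) * e := by
          gcongr
          · exact le_self_add
          · exact hZ.le.trans (min_le_right 1 e)
      _ ≤ _ := ENNReal.mul_div_le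
  calc _ ≤ _ := mdNorm_sub_le_add _ (Φ Y).toFun _
    _ ≤ δ := (add_le_add hΦ le_rfl).trans (tsub_add_cancel_of_le hδ.le).le
    _ < ε := hδε

end Norms

/-! ### Scaled norms on the forest algebra -/

section ScaledNorms

variable {d P : ℕ} {s : Set ℕ}

/-- The projection onto the linear combinations of forests with less than `P` vertices. -/
def trunc (d P : ℕ) : ForestAlg d →ₗ[ℝ] ForestAlg d :=
  linExt fun ζ => if forestSize ζ < P then ofForest ζ else 0

theorem trunc_ofForest (ζ : Forest d) :
    trunc d P (ofForest ζ) = if forestSize ζ < P then ofForest ζ else 0 :=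
  linExt_ofForest _ ζ

theorem coeff_trunc (x : ForestAlg d) (ζ : Forest d) :
    (trunc d P x).coeff ζ = if forestSize ζ < P then x.coeff ζ else 0 := by
  have h : coeffFunctional ζ ∘ₗ trunc d P = if forestSize ζ < P then coeffFunctional ζ else 0 := by
    refine forestAlg_hom_ext fun ξ => ?_
    rw [LinearMap.comp_apply, trunc_ofForest]
    rcases eq_or_ne ξ ζ with rfl | hξ
    · split_ifs <;> simp
    · have h0 : coeffFunctional ζ (ofForest ξ) = 0 := by
        simp [coeffFunctional_apply, ofForest, hξ]
      split_ifs <;> simp [h0]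
  have hx := LinearMap.congr_fun h x
  split_ifs at hx ⊢ <;> exact hx

theorem trunc_eq_zero {x : ForestAlg d} (hx : x ∈ sizeSupported d (Set.Ici P)) :
    trunc d P x = 0 :=
  AddMonoidAlgebra.ext <| Finsupp.ext fun ζ => by
    rw [coeff_trunc, AddMonoidAlgebra.coeff_zero, Finsupp.zero_apply, ite_eq_right_iff]
    exact fun hζ => mem_sizeSupported.1 hx ζ (not_le.2 hζ)

theorem sub_trunc_mem_sizeSupported {x : ForestAlg d} (hx : x ∈ sizeSupported d s) :
    x - trunc d P x ∈ sizeSupported d (s ∩ Set.Ici P) :=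
  mem_sizeSupported.2 fun ζ hζ => by
    rw [AddMonoidAlgebra.coeff_sub, Finsupp.sub_apply, coeff_trunc]
    split_ifs with hP
    · exact sub_self _
    · rw [sub_zero]
      exact mem_sizeSupported.1 hx ζ fun hs => hζ ⟨hs, not_lt.1 hP⟩

/-- The `ℓ¹` norm on the forest algebra. -/
def l1Norm (d : ℕ) : Seminorm ℝ (ForestAlg d) := weightSeminorm 1

/-- The weight `r ^ |ζ|` of forests with less than `P` vertices; larger forests have weight zero. -/
def truncWeight (P : ℕ) (r : NNReal) (ζ : Forest d) : NNReal :=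
  if forestSize ζ < P then r ^ forestSize ζ else 0

/-- The seminorm `∑ r ^ |ζ| |x_ζ|`, the sum running over the forests with less than `P` vertices.
For `r = |t - s| ^ γ` it measures increments between the points `s` and `t`. -/
def truncNorm (d P : ℕ) (r : NNReal) : Seminorm ℝ (ForestAlg d) := weightSeminorm (truncWeight P r)

theorem isAlgSeminorm_l1Norm : IsAlgSeminorm (l1Norm d) :=
  isAlgSeminorm_weightSeminorm le_rfl fun _ _ => by simp

theorem truncWeight_add_le (r : NNReal) (ζ ξ : Forest d) :
    truncWeight P r (ζ + ξ) ≤ truncWeight P r ζ * truncWeight P r ξ := by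
  simp only [truncWeight, forestSize_add]
  by_cases h : forestSize ζ + forestSize ξ < P
  · rw [if_pos h, if_pos (by omega), if_pos (by omega), pow_add]
  · rw [if_neg h]
    exact zero_le

theorem truncWeight_le_one {r : NNReal} (hr : r ≤ 1) (ζ : Forest d) : truncWeight P r ζ ≤ 1 := by
  unfold truncWeight
  split_ifs
  · exact pow_le_one₀ (zero_le) hr
  · exact zero_le_one

theorem isAlgSeminorm_truncNorm (r : NNReal) : IsAlgSeminorm (truncNorm d P r) :=
  isAlgSeminorm_weightSeminorm (by rw [truncWeight, forestSize_zero]; split_ifs <;> simp)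
    (truncWeight_add_le r)

variable {r : NNReal}

theorem truncNorm_le_l1Norm (hr : r ≤ 1) (x : ForestAlg d) : truncNorm d P r x ≤ l1Norm d x := by
  rw [← one_mul (l1Norm d x)]
  refine seminorm_linearMap_le_weightSeminorm _ LinearMap.id x fun ζ _ => ?_
  rw [LinearMap.id_apply, truncNorm, weightSeminorm_single, abs_one]
  exact mul_le_mul_of_nonneg_left (truncWeight_le_one hr ζ) zero_le_one

theorem abs_coeff_le_l1Norm (x : ForestAlg d) (ζ : Forest d) : |x.coeff ζ| ≤ l1Norm d x := by
  simpa [l1Norm] using abs_coeff_mul_le_weightSeminorm 1 x ζ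

theorem abs_coeff_mul_le_truncNorm (x : ForestAlg d) {ζ : Forest d} (hζ : forestSize ζ < P) :
    |x.coeff ζ| * r ^ forestSize ζ ≤ truncNorm d P r x := by
  simpa [truncNorm, truncWeight, hζ] using abs_coeff_mul_le_weightSeminorm (truncWeight P r) x ζ

theorem truncNorm_le_card_mul (x : ForestAlg d) {c : ℝ}
    (h : ∀ ζ, forestSize ζ < P → |x.coeff ζ| * r ^ forestSize ζ ≤ c) :
    truncNorm d P r x ≤ (smallForests d P).card * c := by
  have h_large : ∀ ζ ∉ smallForests d P, truncWeight P r ζ = 0 := fun ζ hζ =>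
    if_neg (mem_smallForests.not.1 hζ)
  rw [truncNorm, weightSeminorm_eq_sum fun ζ hζ => Or.inr (h_large ζ hζ), ← nsmul_eq_mul]
  refine Finset.sum_le_card_nsmul _ _ _ fun ζ hζ => ?_
  simpa [truncWeight, mem_smallForests.1 hζ] using h ζ (mem_smallForests.1 hζ)

theorem l1Norm_le_card_mul {x : ForestAlg d} {c : ℝ} (hx : x ∈ sizeSupported d (Set.Iio P))
    (h : ∀ ζ, |x.coeff ζ| ≤ c) : l1Norm d x ≤ (smallForests d P).card * c := by
  rw [l1Norm, weightSeminorm_eq_sum (s := smallForests d P) fun ζ hζ =>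
    Or.inl (mem_sizeSupported.1 hx ζ (mem_smallForests.not.1 hζ)), ← nsmul_eq_mul]
  exact Finset.sum_le_card_nsmul _ _ _ fun ζ _ => by simpa using h ζ

theorem l1Norm_sub_trunc_le (x : ForestAlg d) : l1Norm d (x - trunc d P x) ≤ l1Norm d x := by
  rw [← one_mul (l1Norm d x)]
  refine seminorm_linearMap_le_weightSeminorm _ (LinearMap.id - trunc d P) x fun ζ _ => ?_
  have h : l1Norm d (ofForest ζ) = 1 := by simp [l1Norm, ofForest, weightSeminorm_single]
  change l1Norm d (ofForest ζ - trunc d P (ofForest ζ)) ≤ _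
  rw [trunc_ofForest]
  split_ifs <;> simp [h]

/-- Uniform boundedness, in the scaled norm with scale `r`, of an algebra morphism on the forests
with at most `Q` vertices. -/
def ScaledBound (A : ForestAlg d →ₐ[ℝ] ForestAlg d) (P Q : ℕ) (r : NNReal) (C : ℝ) : Prop :=
  ∀ ζ : Forest d, forestSize ζ ≤ Q → truncNorm d P r (A (ofForest ζ)) ≤ C * r ^ forestSize ζ

variable {A : ForestAlg d →ₐ[ℝ] ForestAlg d} {Q : ℕ} {C : ℝ}

theorem ScaledBound.le (hA : ScaledBound A P Q r C) (hC : 0 ≤ C) (hr : r ≤ 1) {m : ℕ}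
    {x : ForestAlg d} (hx : x ∈ sizeSupported d (Set.Icc m Q)) :
    truncNorm d P r (A x) ≤ C * r ^ m * l1Norm d x := by
  refine seminorm_linearMap_le_weightSeminorm _ A.toLinearMap x fun ζ hζ => ?_
  have hζ_mem : forestSize ζ ∈ Set.Icc m Q := by
    by_contra h
    exact Finsupp.mem_support_iff.1 hζ (mem_sizeSupported.1 hx ζ h)
  simp only [Pi.one_apply, NNReal.coe_one, mul_one]
  exact (hA ζ hζ_mem.2).trans
    (mul_le_mul_of_nonneg_left (pow_le_pow_of_le_one r.2 hr hζ_mem.1) hC)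

theorem ScaledBound.sub_trunc_le (hA : ScaledBound A P Q r C) (hC : 0 ≤ C) (hr : r ≤ 1)
    {x : ForestAlg d} (hx : x ∈ sizeSupported d (Set.Iic Q)) :
    truncNorm d P r (A (x - trunc d P x)) ≤ C * r ^ P * l1Norm d x := by
  have hx_mem : x - trunc d P x ∈ sizeSupported d (Set.Icc P Q) := by
    simpa only [Set.inter_comm, Set.Ici_inter_Iic] using sub_trunc_mem_sizeSupported (P := P) hx
  exact (hA.le hC hr hx_mem).trans
    (mul_le_mul_of_nonneg_left (l1Norm_sub_trunc_le x) (by positivity))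

end ScaledNorms

/-! ### Composition with smooth functions in the forest algebra -/

section Composition

variable {d P : ℕ}

/-- An element of the forest algebra without its component along the empty forest. -/
def reduced (x : ForestAlg d) : ForestAlg d := x - x.coeff 0 • 1

theorem smul_one_add_reduced (x : ForestAlg d) : x.coeff 0 • 1 + reduced x = x :=
  add_sub_cancel _ _

theorem reduced_add (x y : ForestAlg d) : reduced (x + y) = reduced x + reduced y := by
  simp only [reduced, AddMonoidAlgebra.coeff_add, Finsupp.add_apply, add_smul, add_sub_add_comm]

theorem reduced_smul (c : ℝ) (x : ForestAlg d) : reduced (c • x) = c • reduced x := by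
  simp only [reduced, AddMonoidAlgebra.coeff_smul, Finsupp.smul_apply, smul_sub, smul_assoc]

theorem reduced_mem_sizeSupported {s : Set ℕ} {x : ForestAlg d} (hx : x ∈ sizeSupported d s) :
    reduced x ∈ sizeSupported d (s \ {0}) := by
  refine mem_sizeSupported.2 fun ζ hζ => ?_
  rcases eq_or_ne ζ 0 with rfl | h0
  · simp [reduced]
  · have hζs : forestSize ζ ∉ s := fun h => hζ ⟨h, forestSize_eq_zero.not.2 h0⟩
    simp [reduced, mem_sizeSupported.1 hx ζ hζs, AddMonoidAlgebra.one_def, h0.symm]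

theorem reduced_mem_sizeSupported_Ici (x : ForestAlg d) :
    reduced x ∈ sizeSupported d (Set.Ici 1) :=
  sizeSupported_mono (fun _ hn => Nat.one_le_iff_ne_zero.2 hn.2)
    (reduced_mem_sizeSupported (mem_sizeSupported.2 fun _ h => absurd (Set.mem_univ _) h))

theorem reduced_mem_sizeSupported_Icc {n : ℕ} {x : ForestAlg d}
    (hx : x ∈ sizeSupported d (Set.Iic n)) : reduced x ∈ sizeSupported d (Set.Icc 1 n) :=
  sizeSupported_mono (fun _ hn => Set.mem_Icc.2 ⟨Nat.one_le_iff_ne_zero.2 hn.2, hn.1⟩)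
    (reduced_mem_sizeSupported hx)

theorem l1Norm_reduced_le (x : ForestAlg d) : l1Norm d (reduced x) ≤ 2 * l1Norm d x :=
  calc l1Norm d (reduced x) ≤ l1Norm d x + |x.coeff 0| * l1Norm d 1 := by
        rw [reduced, ← Real.norm_eq_abs, ← map_smul_eq_mul]
        exact map_sub_le_add _ _ _
    _ ≤ l1Norm d x + l1Norm d x * 1 := by
        gcongr
        exacts [abs_coeff_le_l1Norm x 0, isAlgSeminorm_l1Norm.one_le]
    _ = 2 * l1Norm d x := by ring

/-- The composition `∑_{n < P} g⁽ⁿ⁾(x^𝟏)/n! (x - x^𝟏 𝟏)ⁿ` of `x` with the function `g`, not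
truncated in the number of vertices. -/
def compose (g : ℝ → ℝ) (P : ℕ) (x : ForestAlg d) : ForestAlg d :=
  taylorSum g P (x.coeff 0) (reduced x)

theorem compose_mem_sizeSupported {n : ℕ} {x : ForestAlg d} (hx : x ∈ sizeSupported d (Set.Iic n))
    (g : ℝ → ℝ) : compose g P x ∈ sizeSupported d (Set.Iic (P * n)) :=
  taylorSum_mem_sizeSupported_Iic
    (sizeSupported_mono (fun _ h => h.2) (reduced_mem_sizeSupported_Icc hx)) g P _

variable {f g : ℝ → ℝ} {B C D : ℝ}

theorem l1Norm_compose_le (hD : 1 ≤ D) (hB : ∀ n < P, ∀ y, |y| ≤ D → |iteratedDeriv n g y| ≤ B)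
    {x : ForestAlg d} (hx : l1Norm d x ≤ D) :
    l1Norm d (compose g P x) ≤ P * (B * (2 * D) ^ P) :=
  isAlgSeminorm_l1Norm.taylorSum_le (by linarith)
    (fun n hn => hB n hn _ ((abs_coeff_le_l1Norm x 0).trans hx))
    ((l1Norm_reduced_le x).trans (by linarith))

theorem compose_add_smul (g : ℝ → ℝ) (x v : ForestAlg d) (θ : ℝ) :
    compose g P (x + θ • v) =
      taylorSum g P (x.coeff 0 + θ * v.coeff 0) (reduced x + θ • reduced v) := by
  rw [compose, reduced_add, reduced_smul]
  simp

theorem hasDerivAt_compose_line (hP : 0 < P) (hf : ContDiff ℝ P f) (x v : ForestAlg d)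
    {ℓ : ForestAlg d →ₗ[ℝ] ℝ} (hℓ : ∀ z ∈ sizeSupported d (Set.Ici P), ℓ z = 0) (θ : ℝ) :
    HasDerivAt (fun θ : ℝ => ℓ (compose f P (x + θ • v)))
      (ℓ (compose (deriv f) P (x + θ • v) * v)) θ := by
  have h_line : reduced x + θ • reduced v ∈ sizeSupported d (Set.Ici 1) :=
    add_mem (reduced_mem_sizeSupported_Ici x)
      (Submodule.smul_mem _ _ (reduced_mem_sizeSupported_Ici v))
  have h_top : (reduced x + θ • reduced v) ^ (P - 1) * reduced v ∈ sizeSupported d (Set.Ici P) :=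
    mul_mem_sizeSupported (fun m hm n hn => Set.mem_Ici.2 <| by
      rw [Set.mem_Ici] at hm hn; omega)
      (pow_mem_sizeSupported_Ici h_line (P - 1)) (reduced_mem_sizeSupported_Ici v)
  simp only [compose_add_smul]
  simpa only [smul_one_add_reduced] using
    hasDerivAt_linearMap_taylorSum hf (x.coeff 0) (v.coeff 0) (reduced x) (reduced v) ℓ θ
      (hℓ _ h_top)

theorem abs_map_compose_sub_sub_le (hP : 0 < P) (hf : ContDiff ℝ P f) {x y x' y' : ForestAlg d}
    {ℓ ℓ' : ForestAlg d →ₗ[ℝ] ℝ} (hℓ : ∀ z ∈ sizeSupported d (Set.Ici P), ℓ z = 0)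
    (hℓ' : ∀ z ∈ sizeSupported d (Set.Ici P), ℓ' z = 0) {c : ℝ}
    (h : ∀ θ ∈ Set.Icc (0 : ℝ) 1, |ℓ (compose (deriv f) P (x + θ • (y - x)) * (y - x)) -
      ℓ' (compose (deriv f) P (x' + θ • (y' - x')) * (y' - x'))| ≤ c) :
    |ℓ (compose f P y - compose f P x) - ℓ' (compose f P y' - compose f P x')| ≤ c := by
  have h_deriv (θ : ℝ) := (hasDerivAt_compose_line hP hf x (y - x) hℓ θ).sub
    (hasDerivAt_compose_line hP hf x' (y' - x') hℓ' θ)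
  have h_mvt := (convex_Icc (0 : ℝ) 1).norm_image_sub_le_of_norm_hasDerivWithin_le
    (fun θ _ => (h_deriv θ).hasDerivWithinAt) h (Set.left_mem_Icc.2 zero_le_one)
    (Set.right_mem_Icc.2 zero_le_one)
  simpa [sub_sub_sub_comm] using h_mvt

theorem abs_coeff_compose_sub_le (hP : 0 < P) (hf : ContDiff ℝ P f) (hD : 1 ≤ D)
    (hB : ∀ n < P, ∀ y, |y| ≤ D → |iteratedDeriv n (deriv f) y| ≤ B) {x y : ForestAlg d}
    (hx : l1Norm d x ≤ D) (hy : l1Norm d y ≤ D) {ζ : Forest d} (hζ : forestSize ζ < P) :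
    |(compose f P y - compose f P x).coeff ζ| ≤ P * (B * (2 * D) ^ P) * l1Norm d (y - x) := by
  have h := abs_map_compose_sub_sub_le hP hf (x := x) (y := y) (x' := x) (y' := y)
    (ℓ := coeffFunctional ζ) (ℓ' := 0) (fun z hz => mem_sizeSupported.1 hz ζ (not_le.2 hζ))
    (fun _ _ => rfl) (c := P * (B * (2 * D) ^ P) * l1Norm d (y - x)) fun θ hθ => by
      rw [LinearMap.zero_apply, sub_zero]
      refine (abs_coeff_le_l1Norm _ ζ).trans ((isAlgSeminorm_l1Norm.mul_le _ _).trans ?_)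
      gcongr
      exact l1Norm_compose_le hD hB (seminorm_line_le _ hx hy hθ)
  simpa only [LinearMap.zero_apply, sub_zero, coeffFunctional_apply] using h

end Composition

/-! ### Increments of compositions -/

section Increments

variable {d P : ℕ} {A : ForestAlg d →ₐ[ℝ] ForestAlg d} {r ρ : NNReal} {B C D ε : ℝ} {f g : ℝ → ℝ}
  {x x' y y' v v' : ForestAlg d}

/-- The bounds, with constant `c`, satisfied by the values `x` and `x'` of a modelled distribution
at two points: `A` is the transport from the second point to the first one, `r` the scale and `ρ`
the size of the increment. -/
structure TwoPointBound (A : ForestAlg d →ₐ[ℝ] ForestAlg d) (P : ℕ) (r ρ : NNReal) (c : ℝ)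
    (x x' : ForestAlg d) : Prop where
  left_le : l1Norm d x ≤ c
  right_le : l1Norm d x' ≤ c
  right_mem : x' ∈ sizeSupported d (Set.Iic P)
  sub_le : truncNorm d P r (x - A x') ≤ c * ρ

theorem TwoPointBound.line (hx : TwoPointBound A P r ρ D x x') (hy : TwoPointBound A P r ρ D y y')
    {θ : ℝ} (hθ : θ ∈ Set.Icc (0 : ℝ) 1) :
    TwoPointBound A P r ρ D (x + θ • (y - x)) (x' + θ • (y' - x')) where
  left_le := seminorm_line_le _ hx.left_le hy.left_le hθ
  right_le := seminorm_line_le _ hx.right_le hy.right_le hθ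
  right_mem := add_mem hx.right_mem (Submodule.smul_mem _ _ (sub_mem hy.right_mem hx.right_mem))
  sub_le := by
    have h : x + θ • (y - x) - A (x' + θ • (y' - x')) =
        (x - A x') + θ • ((y - A y') - (x - A x')) := by
      simp only [map_add, map_smul, map_sub, smul_sub]
      abel
    exact h ▸ seminorm_line_le _ hx.sub_le hy.sub_le hθ

theorem map_eq_smul_one_add (A : ForestAlg d →ₐ[ℝ] ForestAlg d) (x : ForestAlg d) :
    A x = x.coeff 0 • 1 + A (reduced x) := by
  conv_lhs => rw [← smul_one_add_reduced x, map_add, map_smul, map_one]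

/-- The data entering the comparison of two points: a transport `A` from the second point to the
first one that is bounded with constant `C` at the scale `r ≤ 1`, and a size `ρ ≤ 1` of the
increments such that all forests with at least `P` vertices are negligible, `r ^ P ≤ ρ`. The number
`P * P + P` bounds the size of the forests occurring in a product `compose g P x * v`. -/
structure IsTransport (A : ForestAlg d →ₐ[ℝ] ForestAlg d) (P : ℕ) (r ρ : NNReal) (C : ℝ) :
    Prop where
  scaledBound : ScaledBound A P (P * P + P) r C
  one_le : 1 ≤ C
  scale_le_one : r ≤ 1
  increment_le_one : ρ ≤ 1
  pow_le : r ^ P ≤ ρ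

namespace IsTransport

variable (hA : IsTransport A P r ρ C)
include hA

theorem max_pow_le (hP : 0 < P) : max r ρ ^ P ≤ ρ := by
  rcases max_choice r ρ with h | h <;> rw [h]
  exacts [hA.pow_le, pow_le_of_le_one zero_le hA.increment_le_one hP.ne']

theorem truncNorm_map_reduced_le (hx : TwoPointBound A P r ρ D x x') :
    truncNorm d P r (A (reduced x')) ≤ 2 * (C * D) * r :=
  have hC := hA.one_le
  calc truncNorm d P r (A (reduced x')) ≤ C * r ^ 1 * l1Norm d (reduced x') :=
        hA.scaledBound.le (by linarith) hA.scale_le_one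
          (sizeSupported_mono (Set.Icc_subset_Icc_right (Nat.le_add_left P _))
            (reduced_mem_sizeSupported_Icc hx.right_mem))
    _ ≤ C * r ^ 1 * (2 * D) := by
        gcongr
        exact (l1Norm_reduced_le x').trans (mul_le_mul_of_nonneg_left hx.right_le zero_le_two)
    _ = _ := by ring

theorem abs_coeff_zero_sub_le (hP : 0 < P) (hx : TwoPointBound A P r ρ D x x') :
    |x'.coeff 0 - x.coeff 0| ≤ 3 * (C * D) * max r ρ := by
  have hC := hA.one_le
  have hD : 0 ≤ D := (apply_nonneg _ _).trans hx.left_le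
  have h_coeff (z : ForestAlg d) : |z.coeff 0| ≤ truncNorm d P r z := by
    simpa [forestSize_zero] using abs_coeff_mul_le_truncNorm (r := r) z (ζ := 0) hP
  have h_eq : x'.coeff 0 - x.coeff 0 = -((x - A x').coeff 0 + (A (reduced x')).coeff 0) := by
    rw [map_eq_smul_one_add A x']
    simp only [AddMonoidAlgebra.coeff_sub, AddMonoidAlgebra.coeff_add, AddMonoidAlgebra.coeff_smul,
      Finsupp.sub_apply, Finsupp.add_apply, Finsupp.smul_apply, AddMonoidAlgebra.coeff_one_zero,
      smul_eq_mul, mul_one]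
    ring
  calc |x'.coeff 0 - x.coeff 0| ≤ |(x - A x').coeff 0| + |(A (reduced x')).coeff 0| := by
        rw [h_eq, abs_neg]
        exact abs_add_le _ _
    _ ≤ D * ρ + 2 * (C * D) * r :=
        add_le_add ((h_coeff _).trans hx.sub_le)
          ((h_coeff _).trans (hA.truncNorm_map_reduced_le hx))
    _ ≤ C * D * max r ρ + 2 * (C * D) * max r ρ := by
        gcongr
        exacts [le_mul_of_one_le_left hD hC, le_max_right _ _, le_max_left _ _]
    _ = _ := by ring

theorem truncNorm_taylorSum_sub_le (hD : 1 ≤ D)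
    (hB : ∀ n < P, ∀ y, |y| ≤ D → |iteratedDeriv n g y| ≤ B) (hP : 0 < P)
    (hx : TwoPointBound A P r ρ D x x') :
    truncNorm d P r (compose g P x - taylorSum g P (x.coeff 0)
      (A (reduced x') + (x'.coeff 0 - x.coeff 0) • 1)) ≤
      P * (B * (P * (5 * (C * D)) ^ P * (D * ρ))) := by
  have hC := hA.one_le
  have hCD : D ≤ C * D := le_mul_of_one_le_left (by linarith) hC
  have h_max : ((max r ρ : NNReal) : ℝ) ≤ 1 := max_le hA.scale_le_one hA.increment_le_one
  have h_x : truncNorm d P r (reduced x) ≤ 5 * (C * D) :=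
    calc truncNorm d P r (reduced x) ≤ 2 * l1Norm d x :=
          (truncNorm_le_l1Norm hA.scale_le_one _).trans (l1Norm_reduced_le x)
      _ ≤ 5 * (C * D) := by linarith [hx.left_le]
  have h_x' : truncNorm d P r (A (reduced x') + (x'.coeff 0 - x.coeff 0) • 1) ≤ 5 * (C * D) :=
    calc _ ≤ 2 * (C * D) * r + 3 * (C * D) * max r ρ * 1 := by
          refine (map_add_le_add _ _ _).trans ?_
          rw [map_smul_eq_mul, Real.norm_eq_abs]
          exact add_le_add (hA.truncNorm_map_reduced_le hx)
            (mul_le_mul (hA.abs_coeff_zero_sub_le hP hx) (isAlgSeminorm_truncNorm r).one_le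
              (apply_nonneg _ _) (by positivity))
      _ ≤ 2 * (C * D) * 1 + 3 * (C * D) * 1 * 1 := by
          gcongr
          exact hA.scale_le_one
      _ = 5 * (C * D) := by ring
  have h_sub : reduced x - (A (reduced x') + (x'.coeff 0 - x.coeff 0) • 1) = x - A x' := by
    rw [map_eq_smul_one_add A x', reduced, sub_smul]
    abel
  have hB' (n) (hn : n < P) : |iteratedDeriv n g (x.coeff 0)| ≤ B :=
    hB n hn _ ((abs_coeff_le_l1Norm x 0).trans hx.left_le)
  have hB0 : 0 ≤ B := (abs_nonneg _).trans (hB' 0 hP)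
  refine ((isAlgSeminorm_truncNorm r).taylorSum_sub_le (by linarith) hB' h_x h_x').trans ?_
  rw [h_sub]
  gcongr
  exact hx.sub_le

theorem truncNorm_taylorSum_sub_map_compose_le (hg : ContDiff ℝ P g)
    (hB : ∀ y, |y| ≤ D → |iteratedDeriv P g y| ≤ B) (hP : 0 < P)
    (hx : TwoPointBound A P r ρ D x x') :
    truncNorm d P r (taylorSum g P (x.coeff 0) (A (reduced x') + (x'.coeff 0 - x.coeff 0) • 1) -
      A (compose g P x')) ≤ P * (B * ((3 * (C * D)) ^ P * ρ)) := by
  have hC := hA.one_le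
  have hx0 := (abs_coeff_le_l1Norm x 0).trans hx.left_le
  have hD : 0 ≤ D := (abs_nonneg _).trans hx0
  have hB0 : 0 ≤ B := (abs_nonneg _).trans (hB _ hx0)
  rw [compose, map_taylorSum]
  calc _ ≤ P * (B * (3 * (C * D) * max r ρ) ^ P) :=
        (isAlgSeminorm_truncNorm r).taylorSum_add_smul_one_sub_le hg hB hx0
          ((abs_coeff_le_l1Norm x' 0).trans hx.right_le)
          ((hA.truncNorm_map_reduced_le hx).trans <| by
            gcongr
            exacts [by norm_num, le_max_left _ _])
          (hA.abs_coeff_zero_sub_le hP hx)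
    _ ≤ _ := by
        rw [mul_pow]
        gcongr
        exact_mod_cast hA.max_pow_le hP

theorem truncNorm_compose_sub_map_le (hg : ContDiff ℝ P g) (hD : 1 ≤ D)
    (hB : ∀ n ≤ P, ∀ y, |y| ≤ D → |iteratedDeriv n g y| ≤ B) (hP : 0 < P)
    (hx : TwoPointBound A P r ρ D x x') :
    truncNorm d P r (compose g P x - A (compose g P x')) ≤
      P * B * (P * (5 * (C * D)) ^ P * D + (3 * (C * D)) ^ P) * ρ :=
  calc _ ≤ P * (B * (P * (5 * (C * D)) ^ P * (D * ρ))) + P * (B * ((3 * (C * D)) ^ P * ρ)) := by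
        refine (le_map_sub_add_map_sub _ _ _ _).trans <| add_le_add
          (hA.truncNorm_taylorSum_sub_le hD (fun n hn => hB n hn.le) hP hx)
          (hA.truncNorm_taylorSum_sub_map_compose_le hg (hB P le_rfl) hP hx)
    _ = _ := by ring

theorem truncNorm_mul_sub_map_trunc_mul_le {w w' : ForestAlg d} {E F : ℝ}
    (hw : truncNorm d P r (w - A w') ≤ E * ρ) (hw' : l1Norm d w' ≤ F)
    (hw'_mem : w' ∈ sizeSupported d (Set.Iic (P * P))) (hv : TwoPointBound A P r ρ ε v v') :
    truncNorm d P r (w * v - A (trunc d P (w' * v'))) ≤ (E + 2 * (C * F)) * (ρ * ε) := by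
  have hC : 0 ≤ C := zero_le_one.trans hA.one_le
  have hF : 0 ≤ F := (apply_nonneg _ _).trans hw'
  have h_transport : truncNorm d P r (A w') ≤ C * F := by
    simpa using (hA.scaledBound.le (m := 0) hC hA.scale_le_one
      (sizeSupported_mono (fun n hn => Set.mem_Icc.2 ⟨n.zero_le, Nat.le_add_right_of_le hn⟩)
        hw'_mem)).trans (mul_le_mul_of_nonneg_left hw' (by positivity))
  have h_mem : w' * v' ∈ sizeSupported d (Set.Iic (P * P + P)) :=
    mul_mem_sizeSupported (fun m hm n hn => Set.mem_Iic.2 (add_le_add hm hn)) hw'_mem hv.right_mem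
  have h_main : truncNorm d P r (w * v - A w' * A v') ≤ E * ρ * ε + C * F * (ε * ρ) :=
    ((isAlgSeminorm_truncNorm r).mul_sub_mul_le w (A w') v (A v')).trans <| add_le_add
      (mul_le_mul hw ((truncNorm_le_l1Norm hA.scale_le_one v).trans hv.left_le)
        (apply_nonneg _ _) ((apply_nonneg _ _).trans hw))
      (mul_le_mul h_transport hv.sub_le (apply_nonneg _ _) (by positivity))
  have h_tail : truncNorm d P r (A (w' * v' - trunc d P (w' * v'))) ≤ C * ρ * (F * ε) :=
    (hA.scaledBound.sub_trunc_le hC hA.scale_le_one h_mem).trans <| by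
      gcongr
      · exact_mod_cast hA.pow_le
      · exact (isAlgSeminorm_l1Norm.mul_le _ _).trans
          (mul_le_mul hw' hv.right_le (apply_nonneg _ _) hF)
  have h_split : w * v - A (trunc d P (w' * v')) =
      (w * v - A w' * A v') + A (w' * v' - trunc d P (w' * v')) := by
    rw [map_sub, map_mul A]
    abel
  calc _ ≤ E * ρ * ε + C * F * (ε * ρ) + C * ρ * (F * ε) :=
        h_split ▸ (map_add_le_add _ _ _).trans (add_le_add h_main h_tail)
    _ = _ := by ring

end IsTransport

/-- By the mean value theorem along the lines from `x` to `y` and from `x'` to `y'`, the estimate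
reduces to one for the products `compose (deriv f) P z * (y - x)`, which are linear in `y - x`. -/
theorem exists_truncNorm_compose_sub_sub_le (hP : 0 < P) (hf : ContDiff ℝ (P + 1) f) (hD : 1 ≤ D)
    (hB : ∀ n ≤ P, ∀ y, |y| ≤ D → |iteratedDeriv n (deriv f) y| ≤ B) (C : ℝ) :
    ∃ E, ∀ {A : ForestAlg d →ₐ[ℝ] ForestAlg d} {r ρ : NNReal} {ε : ℝ} {x x' y y' : ForestAlg d},
      IsTransport A P r ρ C → TwoPointBound A P r ρ D x x' → TwoPointBound A P r ρ D y y' →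
      TwoPointBound A P r ρ ε (y - x) (y' - x') →
      truncNorm d P r (compose f P y - compose f P x -
        A (trunc d P (compose f P y' - compose f P x'))) ≤ E * (ρ * ε) := by
  refine ⟨(smallForests d P).card * (P * B * (P * (5 * (C * D)) ^ P * D + (3 * (C * D)) ^ P) +
    2 * (C * (P * (B * (2 * D) ^ P)))), fun {A r ρ ε x x' y y'} hA hx hy hv => ?_⟩
  rw [mul_assoc]
  refine truncNorm_le_card_mul _ fun ζ hζ => ?_
  let ℓ : ForestAlg d →ₗ[ℝ] ℝ := (r ^ forestSize ζ : ℝ) • coeffFunctional ζ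
  have abs_ℓ (z : ForestAlg d) : |ℓ z| = |z.coeff ζ| * r ^ forestSize ζ := by
    simp [ℓ, coeffFunctional_apply, abs_mul, mul_comm]
  have h := abs_map_compose_sub_sub_le hP (hf.of_le (by exact_mod_cast P.le_succ)) (x := x)
    (y := y) (x' := x') (y' := y') (ℓ := ℓ) (ℓ' := ℓ ∘ₗ A.toLinearMap ∘ₗ trunc d P)
    (fun z hz => by simp [ℓ, coeffFunctional_apply, mem_sizeSupported.1 hz ζ (not_le.2 hζ)])
    (fun z hz => by simp [trunc_eq_zero hz])
    (c := (P * B * (P * (5 * (C * D)) ^ P * D + (3 * (C * D)) ^ P) +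
      2 * (C * (P * (B * (2 * D) ^ P)))) * (ρ * ε)) fun θ hθ => by
        have hz := hx.line hy hθ
        rw [LinearMap.comp_apply, ← map_sub, abs_ℓ]
        exact (abs_coeff_mul_le_truncNorm _ hζ).trans <| hA.truncNorm_mul_sub_map_trunc_mul_le
          (hA.truncNorm_compose_sub_map_le ((contDiff_succ_iff_deriv.1 hf).2.2) hD hB hP hz)
          (l1Norm_compose_le hD (fun n hn => hB n hn.le) hz.right_le)
          (compose_mem_sizeSupported hz.right_mem _) hv
  rwa [LinearMap.comp_apply, ← map_sub, abs_ℓ] at h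

end Increments

/-! ### Bounds of a bimap on the forest algebra -/

section Transport

variable {d : ℕ} {γ α : ℝ} {g : ForestAlg d →ₐ[ℝ] ℝ} {K : Set ℝ}
  {Γ : ℝ → ℝ → (ModelSpace d →ₗ[ℝ] ModelSpace d)}

theorem homNorm_single_le {S : Type} {deg : S → ℝ} (σ : S) :
    homNorm deg (deg σ) (Finsupp.single σ 1) ≤ 1 := by
  classical
  have h := homNorm_le_card_mul (deg := deg) (β := deg σ) (x := Finsupp.single σ 1) {σ} zero_le_one
    (fun τ _ hτ => Finset.mem_singleton.2 (not_imp_comm.1 Finsupp.single_eq_of_ne hτ))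
    fun τ _ => by rw [Finsupp.single_apply]; split_ifs <;> simp
  simpa using h

theorem rpow_sub_mul_pow {h : ℝ} (h0 : 0 < h) (γ α : ℝ) (n : ℕ) :
    h ^ (α - γ * n) * (h ^ γ) ^ n = h ^ α := by
  rw [← Real.rpow_mul_natCast h0.le, ← Real.rpow_add h0, sub_add_cancel]

theorem exists_abs_coeff_charAction_ofForest_le (hγ : 0 < γ)
    (hΓ : IsBimap (homogeneity γ) (structureGroup d) Γ) (i : Fin d) (hK : IsCompact K)
    (ζ : Forest d) : ∃ c : ℝ, ∀ t ∈ K, ∀ s ∈ K, 0 < dist t s → ∀ g, structAction g = Γ t s → ∀ ξ,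
      |(charAction g (ofForest ζ)).coeff ξ| * (dist t s ^ γ) ^ forestSize ξ ≤
        c * (dist t s ^ γ) ^ forestSize ζ := by
  obtain ⟨c, hc⟩ := hΓ.bound K hK (homogeneity γ (.noise ζ i)) ⟨_, rfl⟩
  refine ⟨max 1 |c|, fun t ht s hs h0 g hg ξ => ?_⟩
  rcases le_or_gt (forestSize ζ) (forestSize ξ) with hle | hlt
  · rw [coeff_charAction_ofForest g hle, ofForest, AddMonoidAlgebra.coeff_single]
    rcases eq_or_ne ζ ξ with rfl | hne
    · rw [Finsupp.single_eq_same, abs_one]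
      gcongr
      exact le_max_left 1 |c|
    · rw [Finsupp.single_eq_of_ne hne.symm, abs_zero, zero_mul]
      positivity
  · have hcoeff : (charAction g (ofForest ζ)).coeff ξ =
        Γ t s (Finsupp.single (.noise ζ i) 1) (.noise ξ i) := by
      rw [← hg, ← mulXi_ofForest, structAction_mulXi, mulXi_noise]
    have hdeg : homogeneity γ (.noise ζ i) - homogeneity γ (.noise ξ i) =
        γ * forestSize ζ - γ * forestSize ξ := by
      simp only [homogeneity]
      ring
    have hdeg_lt : homogeneity γ (.noise ξ i) < homogeneity γ (.noise ζ i) := by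
      rw [← sub_pos, hdeg, sub_pos]
      gcongr
    have hΓ_le := hc t ht s hs _ (Finsupp.single_mem_supported ℝ 1 rfl) _ ⟨_, rfl⟩ hdeg_lt
    have hconst : c * homNorm (homogeneity γ) (homogeneity γ (.noise ζ i))
        (Finsupp.single (.noise ζ i) 1) ≤ max 1 |c| :=
      (mul_le_mul (le_abs_self c) (homNorm_single_le _) (homNorm_nonneg _ _)
        (abs_nonneg c)).trans ((mul_one |c|).trans_le (le_max_right 1 |c|))
    rw [hdeg] at hΓ_le
    rw [hcoeff, ← Real.rpow_mul_natCast h0.le γ (forestSize ζ),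
      ← rpow_sub_mul_pow h0 γ (γ * forestSize ζ) (forestSize ξ), ← mul_assoc]
    gcongr
    exact (abs_apply_le_homNorm _ _).trans (hΓ_le.trans (by gcongr))

theorem exists_scaledBound (hγ : 0 < γ) (hΓ : IsBimap (homogeneity γ) (structureGroup d) Γ)
    (i : Fin d) (hK : IsCompact K) (P Q : ℕ) :
    ∃ C : ℝ, 1 ≤ C ∧ ∀ t ∈ K, ∀ s ∈ K, 0 < dist t s → ∀ g, structAction g = Γ t s →
      ScaledBound (charAction g) P Q (nndist t s ^ γ) C := by
  choose c hc using exists_abs_coeff_charAction_ofForest_le hγ hΓ i hK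
  obtain ⟨C, hC⟩ := ((smallForests d (Q + 1)).finite_toSet.image c).bddAbove
  refine ⟨max 1 ((smallForests d P).card * C), le_max_left _ _,
    fun t ht s hs h0 g hg ζ hζ => ?_⟩
  have hζ_le : c ζ ≤ C :=
    hC (Set.mem_image_of_mem c (mem_smallForests.2 (Nat.lt_succ_of_le hζ)))
  calc truncNorm d P (nndist t s ^ γ) (charAction g (ofForest ζ))
      ≤ (smallForests d P).card * (C * (nndist t s ^ γ : NNReal) ^ forestSize ζ) := by
        refine truncNorm_le_card_mul _ fun ξ _ => ?_
        simp only [NNReal.coe_rpow, coe_nndist]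
        exact (hc ζ t ht s hs h0 g hg ξ).trans (by gcongr)
    _ ≤ _ := by
        rw [← mul_assoc]
        gcongr
        exact le_max_right _ _

theorem exists_isTransport (hγ : 0 < γ) (hα : 0 ≤ α)
    (hΓ : IsBimap (homogeneity γ) (structureGroup d) Γ) (i : Fin d) (hK : IsCompact K) :
    ∃ C : ℝ, ∀ t ∈ K, ∀ s ∈ K, 0 < dist t s → dist t s ≤ 1 → ∀ g, structAction g = Γ t s →
      IsTransport (charAction g) ⌈α / γ⌉₊ (nndist t s ^ γ) (nndist t s ^ α) C := by
  obtain ⟨C, hC, hbound⟩ :=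
    exists_scaledBound hγ hΓ i hK ⌈α / γ⌉₊ (⌈α / γ⌉₊ * ⌈α / γ⌉₊ + ⌈α / γ⌉₊)
  refine ⟨C, fun t ht s hs h0 h1 g hg => ?_⟩
  have hnn_le : nndist t s ≤ 1 := h1
  have hα_le : α ≤ γ * ⌈α / γ⌉₊ := (div_le_iff₀' hγ).1 (Nat.le_ceil _)
  exact
    { scaledBound := hbound t ht s hs h0 g hg
      one_le := hC
      scale_le_one := NNReal.rpow_le_one hnn_le hγ.le
      increment_le_one := NNReal.rpow_le_one hnn_le hα
      pow_le := by
        rw [← NNReal.rpow_mul_natCast]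
        exact NNReal.rpow_le_rpow_of_exponent_ge h0 hnn_le hα_le }

end Transport

/-! ### The lift in terms of the forest algebra -/

section Lift

variable {d : ℕ} {γ α : ℝ} {y : ModelSpace d}

theorem mul_lt_iff_lt_ceil (hγ : 0 < γ) (n : ℕ) : γ * n < α ↔ n < ⌈α / γ⌉₊ := by
  rw [Nat.lt_ceil, lt_div_iff₀ hγ, mul_comm]

theorem homogeneity_noise_lt_iff (hγ : 0 < γ) (ζ : Forest d) (i : Fin d) :
    homogeneity γ (.noise ζ i) < α + γ - 1 ↔ forestSize ζ < ⌈α / γ⌉₊ := by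
  rw [← mul_lt_iff_lt_ceil hγ, homogeneity, sub_lt_sub_iff_right, add_lt_add_iff_right]

theorem exists_eq_noise_of_mulXi_ne_zero {i : Fin d} {x : ForestAlg d} {σ : Sym d}
    (h : mulXi i x σ ≠ 0) : ∃ ζ, σ = .noise ζ i := by
  contrapose! h
  exact mulXi_eq_zero i x h

theorem projBelow_mulXi (hγ : 0 < γ) (i : Fin d) (x : ForestAlg d) :
    projBelow (homogeneity γ) (α + γ - 1) (mulXi i x) = mulXi i (trunc d ⌈α / γ⌉₊ x) := by
  classical
  ext σ
  rw [projBelow, Finsupp.filter_apply]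
  by_cases hσ : ∃ ζ, σ = .noise ζ i
  · obtain ⟨ζ, rfl⟩ := hσ
    simp only [mulXi_noise, coeff_trunc, homogeneity_noise_lt_iff hγ]
  · rw [mulXi_eq_zero i _ (not_exists.1 hσ), mulXi_eq_zero i _ (not_exists.1 hσ), ite_self]

theorem toForestAlg_sub_unit (y : ModelSpace d) :
    toForestAlg (y - Finsupp.single .unit (unitCoeff y)) = reduced (toForestAlg y) := by
  rw [map_sub, ← mul_one (unitCoeff y), ← smul_eq_mul, ← Finsupp.smul_single, map_smul,
    toForestAlg_unit, reduced, coeff_toForestAlg_zero, unitCoeff]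

theorem taylorLift_eq (hγ : 0 < γ) (f : ℝ → ℝ) (i : Fin d) (y : ModelSpace d) :
    taylorLift γ α f i y =
      mulXi i (trunc d ⌈α / γ⌉₊ (compose f ⌈α / γ⌉₊ (toForestAlg y))) := by
  simp only [taylorLift, toForestAlg_sub_unit, ← map_smul, projBelow_mulXi hγ]
  simp only [compose, taylorSum, map_sum, coeff_toForestAlg_zero, unitCoeff]
  refine (Finset.sum_subset
    (Finset.range_subset_range.2 (Nat.ceil_le_floor_add_one (α / γ))) fun n _ hn => ?_).symm
  have hn_mem : reduced (toForestAlg y) ^ n ∈ sizeSupported d (Set.Ici ⌈α / γ⌉₊) :=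
    sizeSupported_mono (Set.Ici_subset_Ici.2 (by simpa using hn))
      (pow_mem_sizeSupported_Ici (reduced_mem_sizeSupported_Ici _) n)
  rw [trunc_eq_zero (Submodule.smul_mem _ _ hn_mem), map_zero]

theorem taylorLift_mem (hγ : 0 < γ) (f : ℝ → ℝ) (i : Fin d) (y : ModelSpace d) :
    taylorLift γ α f i y ∈ sectorYdot d ⊓ below (homogeneity γ) (α + γ - 1) := by
  rw [taylorLift_eq hγ]
  refine ⟨(Finsupp.mem_supported' ℝ _).2 fun σ hσ => mulXi_eq_zero i _ fun ζ h => hσ ⟨ζ, i, h⟩,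
    (Finsupp.mem_supported' ℝ _).2 fun σ hσ => of_not_not fun hne => ?_⟩
  obtain ⟨ζ, rfl⟩ := exists_eq_noise_of_mulXi_ne_zero hne
  rw [mulXi_noise, coeff_trunc] at hne
  exact hne (if_neg ((homogeneity_noise_lt_iff hγ ζ i).not.1 hσ))

theorem toForestAlg_mem_sizeSupported (hγ : 0 < γ) (hy : y ∈ below (homogeneity γ) α) :
    toForestAlg y ∈ sizeSupported d (Set.Iio ⌈α / γ⌉₊) := by
  refine mem_sizeSupported.2 fun ζ hζ => ?_
  obtain h | ⟨σ, hσ, h⟩ := coeff_toForestAlg_cases γ y ζ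
  · exact h
  · refine h.trans ((Finsupp.mem_supported' ℝ y).1 hy σ fun hlt => hζ ?_)
    exact (mul_lt_iff_lt_ceil hγ _).1 (hσ ▸ hlt)

theorem l1Norm_toForestAlg_le (hγ : 0 < γ) (hy : y ∈ below (homogeneity γ) α) {c : ℝ}
    (hc : 0 ≤ c) (h : ∀ σ, homogeneity γ σ < α → |y σ| ≤ c) :
    l1Norm d (toForestAlg y) ≤ (smallForests d ⌈α / γ⌉₊).card * c := by
  refine l1Norm_le_card_mul (toForestAlg_mem_sizeSupported hγ hy) fun ζ => ?_
  obtain hzero | ⟨σ, -, hσ⟩ := coeff_toForestAlg_cases γ y ζ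
  · rwa [hzero, abs_zero]
  · rw [hσ]
    by_cases hlt : homogeneity γ σ < α
    · exact h σ hlt
    · rwa [(Finsupp.mem_supported' ℝ y).1 hy σ hlt, abs_zero]

theorem truncNorm_toForestAlg_le (hγ : 0 < γ) {h c : ℝ} (h0 : 0 < h) (hc : 0 ≤ c) {r : NNReal}
    (hr : r = h ^ γ) (hy : ∀ σ, homogeneity γ σ < α → |y σ| ≤ c * h ^ (α - homogeneity γ σ)) :
    truncNorm d ⌈α / γ⌉₊ r (toForestAlg y) ≤ (smallForests d ⌈α / γ⌉₊).card * (c * h ^ α) := by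
  refine truncNorm_le_card_mul _ fun ζ hζ => ?_
  obtain hzero | ⟨σ, hσ, hcoeff⟩ := coeff_toForestAlg_cases γ y ζ
  · rw [hzero, abs_zero, zero_mul]
    positivity
  · rw [hcoeff, hr, ← rpow_sub_mul_pow h0 γ α (forestSize ζ), ← mul_assoc, ← hσ]
    gcongr
    exact hy σ (hσ.trans_lt ((mul_lt_iff_lt_ceil hγ _).2 hζ))

theorem homNorm_mulXi_le (hγ : 0 < γ) (i : Fin d) (x : ForestAlg d) {β c : ℝ} (hc : 0 ≤ c)
    (hβ : β < α + γ - 1)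
    (h : ∀ ζ, forestSize ζ < ⌈α / γ⌉₊ → homogeneity γ (.noise ζ i) = β → |x.coeff ζ| ≤ c) :
    homNorm (homogeneity γ) β (mulXi i x) ≤ (smallForests d ⌈α / γ⌉₊).card * c := by
  classical
  have hsize : ∀ ζ, homogeneity γ (.noise ζ i) = β → forestSize ζ < ⌈α / γ⌉₊ := fun ζ hζ =>
    (homogeneity_noise_lt_iff hγ ζ i).1 (hζ.trans_lt hβ)
  calc homNorm (homogeneity γ) β (mulXi i x)
      ≤ ((smallForests d ⌈α / γ⌉₊).image (Sym.noise · i)).card * c := by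
        refine homNorm_le_card_mul _ hc (fun σ hσ hne => ?_) fun σ hσ => ?_
        · obtain ⟨ζ, rfl⟩ := exists_eq_noise_of_mulXi_ne_zero hne
          exact Finset.mem_image_of_mem _ (mem_smallForests.2 (hsize ζ hσ))
        · by_cases hne : mulXi i x σ = 0
          · rwa [hne, abs_zero]
          · obtain ⟨ζ, rfl⟩ := exists_eq_noise_of_mulXi_ne_zero hne
            rw [mulXi_noise]
            exact h ζ (hsize ζ hσ) hσ
    _ ≤ _ := by
        gcongr
        exact Finset.card_image_le

end Lift

/-! ### The local Lipschitz bound -/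

section LocalLipschitz

variable {d : ℕ} {γ α : ℝ} {f : ℝ → ℝ} {K : Set ℝ} {F G : ℝ → ModelSpace d} {c D ε : ℝ}
  {Γ : ℝ → ℝ → (ModelSpace d →ₗ[ℝ] ModelSpace d)} {t s : ℝ}

theorem exists_iteratedDeriv_bound {g : ℝ → ℝ} {P : ℕ} (hg : ContDiff ℝ P g) (D : ℝ) :
    ∃ B : ℝ, ∀ n ≤ P, ∀ y, |y| ≤ D → |iteratedDeriv n g y| ≤ B := by
  have h : ∀ n : ℕ, ∃ b : ℝ, n ≤ P → ∀ y, |y| ≤ D → |iteratedDeriv n g y| ≤ b := by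
    intro n
    by_cases hn : n ≤ P
    · obtain ⟨b, hb⟩ := (isCompact_Icc (a := -D) (b := D)).exists_bound_of_continuousOn
        (hg.continuous_iteratedDeriv n (by exact_mod_cast hn)).continuousOn
      exact ⟨b, fun _ y hy => hb y (abs_le.1 hy)⟩
    · exact ⟨0, fun h => absurd h hn⟩
  choose b hb using h
  obtain ⟨B, hB⟩ := ((Set.finite_Iic P).image b).bddAbove
  exact ⟨B, fun n hn y hy => (hb n hn y hy).trans (hB (Set.mem_image_of_mem b hn))⟩

theorem one_le_card_smallForests {P : ℕ} (hP : 0 < P) : 1 ≤ (smallForests d P).card :=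
  Finset.card_pos.2 ⟨0, mem_smallForests.2 (forestSize_zero.trans_lt hP)⟩

theorem l1Norm_toForestAlg_le_of_mdNorm_le (hγ : 0 < γ) (hc : 0 ≤ c)
    (hF : ∀ t, F t ∈ below (homogeneity γ) α)
    (hF_le : mdNorm (homogeneity γ) Γ α K F ≤ ENNReal.ofReal c) (ht : t ∈ K) :
    l1Norm d (toForestAlg (F t)) ≤ (smallForests d ⌈α / γ⌉₊).card * c :=
  l1Norm_toForestAlg_le hγ (hF t) hc fun σ hσ =>
    (abs_apply_le_homNorm _ σ).trans (homNorm_le_of_mdNorm_le hc hF_le ht ⟨σ, rfl⟩ hσ)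

theorem twoPointBound_of_mdNorm_le (hγ : 0 < γ) (hc : 0 ≤ c)
    (hF : ∀ t, F t ∈ below (homogeneity γ) α)
    (hF_le : mdNorm (homogeneity γ) Γ α K F ≤ ENNReal.ofReal c) (ht : t ∈ K) (hs : s ∈ K)
    (h0 : 0 < dist t s) (h1 : dist t s ≤ 1) {g : ForestAlg d →ₐ[ℝ] ℝ}
    (hg : structAction g = Γ t s) :
    TwoPointBound (charAction g) ⌈α / γ⌉₊ (nndist t s ^ γ) (nndist t s ^ α)
      ((smallForests d ⌈α / γ⌉₊).card * c) (toForestAlg (F t)) (toForestAlg (F s)) where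
  left_le := l1Norm_toForestAlg_le_of_mdNorm_le hγ hc hF hF_le ht
  right_le := l1Norm_toForestAlg_le_of_mdNorm_le hγ hc hF hF_le hs
  right_mem := sizeSupported_mono Set.Iio_subset_Iic_self
    (toForestAlg_mem_sizeSupported hγ (hF s))
  sub_le := by
    rw [← toForestAlg_structAction, hg, ← map_sub, mul_assoc, NNReal.coe_rpow, coe_nndist]
    exact truncNorm_toForestAlg_le hγ h0 hc (by simp) fun σ hσ =>
      (abs_apply_le_homNorm _ σ).trans
        (homNorm_sub_le_of_mdNorm_le hc hF_le ht hs h0 h1 ⟨σ, rfl⟩ hσ)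

theorem exists_mdSup_taylorLift_sub_le (hγ : 0 < γ) (hα : 0 < α)
    (hf : ContDiff ℝ (⌈α / γ⌉₊ + 1) f) (i : Fin d) (hD : 1 ≤ D) :
    ∃ C : ℝ, ∀ {F G : ℝ → ModelSpace d} {ε : ℝ}, (∀ t, F t ∈ below (homogeneity γ) α) →
      (∀ t, G t ∈ below (homogeneity γ) α) → 0 ≤ ε →
      mdNorm (homogeneity γ) Γ α K F ≤ ENNReal.ofReal D →
      mdNorm (homogeneity γ) Γ α K G ≤ ENNReal.ofReal D →
      mdNorm (homogeneity γ) Γ α K (fun t => F t - G t) ≤ ENNReal.ofReal ε →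
      mdSup (homogeneity γ) (α + γ - 1) K
          (fun t => taylorLift γ α f i (F t) - taylorLift γ α f i (G t)) ≤
        ENNReal.ofReal (C * ε) := by
  set P := ⌈α / γ⌉₊
  have hP : 0 < P := Nat.ceil_pos.2 (div_pos hα hγ)
  set N : ℝ := ((smallForests d P).card : ℝ)
  have hN : 1 ≤ N := Nat.one_le_cast.2 (one_le_card_smallForests hP)
  have hND : 1 ≤ N * D := one_le_mul_of_one_le_of_one_le hN hD
  obtain ⟨B, hB⟩ := exists_iteratedDeriv_bound (contDiff_succ_iff_deriv.1 hf).2.2 (N * D)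
  have hB0 : 0 ≤ B := (abs_nonneg _).trans (hB 0 P.zero_le 0 (by rw [abs_zero]; positivity))
  refine ⟨N * (P * (B * (2 * (N * D)) ^ P) * N),
    fun {F G ε} hF hG hε hFD hGD hFG => mdSup_le_iff.2 fun t ht β _ hβ => ?_⟩
  have hsub_le : l1Norm d (toForestAlg (F t) - toForestAlg (G t)) ≤ N * ε := by
    rw [← map_sub]
    exact l1Norm_toForestAlg_le_of_mdNorm_le (F := fun t => F t - G t) hγ hε
      (fun t => sub_mem (hF t) (hG t)) hFG ht
  rw [taylorLift_eq hγ, taylorLift_eq hγ, ← map_sub, ← map_sub, mul_assoc, mul_assoc]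
  refine ENNReal.ofReal_le_ofReal
    (homNorm_mulXi_le hγ i _ (by positivity) hβ fun ζ hζ _ => ?_)
  rw [coeff_trunc, if_pos hζ]
  refine (abs_coeff_compose_sub_le hP (hf.of_le (by exact_mod_cast P.le_succ)) hND
    (fun n hn => hB n hn.le)
    (l1Norm_toForestAlg_le_of_mdNorm_le hγ (zero_le_one.trans hD) hG hGD ht)
    (l1Norm_toForestAlg_le_of_mdNorm_le hγ (zero_le_one.trans hD) hF hFD ht) hζ).trans ?_
  gcongr

theorem taylorLift_sub_sub_structAction (hγ : 0 < γ) (i : Fin d) (g : ForestAlg d →ₐ[ℝ] ℝ)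
    (x y x' y' : ModelSpace d) :
    taylorLift γ α f i y - taylorLift γ α f i x -
        structAction g (taylorLift γ α f i y' - taylorLift γ α f i x') =
      mulXi i (trunc d ⌈α / γ⌉₊
          (compose f ⌈α / γ⌉₊ (toForestAlg y) - compose f ⌈α / γ⌉₊ (toForestAlg x)) -
        charAction g (trunc d ⌈α / γ⌉₊
          (compose f ⌈α / γ⌉₊ (toForestAlg y') - compose f ⌈α / γ⌉₊ (toForestAlg x')))) := by
  simp only [taylorLift_eq hγ, ← map_sub, structAction_mulXi]

theorem abs_coeff_le_of_truncNorm_le (h0 : 0 < dist t s) {P : ℕ} {x : ForestAlg d}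
    (h : truncNorm d P (nndist t s ^ γ) x ≤ c * dist t s ^ α) {ζ : Forest d}
    (hζ : forestSize ζ < P) : |x.coeff ζ| ≤ c * dist t s ^ (α - γ * forestSize ζ) := by
  have hpos : 0 < (dist t s ^ γ) ^ forestSize ζ := pow_pos (Real.rpow_pos_of_pos h0 _) _
  refine le_of_mul_le_mul_right ?_ hpos
  rw [mul_assoc, rpow_sub_mul_pow h0]
  simpa using (abs_coeff_mul_le_truncNorm x hζ).trans h

theorem exists_mdHolder_taylorLift_sub_le (hγ : 0 < γ) (hα : 0 < α)
    (hf : ContDiff ℝ (⌈α / γ⌉₊ + 1) f) (hΓ : IsBimap (homogeneity γ) (structureGroup d) Γ)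
    (i : Fin d) (hK : IsCompact K) (hD : 1 ≤ D) :
    ∃ C : ℝ, ∀ {F G : ℝ → ModelSpace d} {ε : ℝ}, (∀ t, F t ∈ below (homogeneity γ) α) →
      (∀ t, G t ∈ below (homogeneity γ) α) → 0 ≤ ε →
      mdNorm (homogeneity γ) Γ α K F ≤ ENNReal.ofReal D →
      mdNorm (homogeneity γ) Γ α K G ≤ ENNReal.ofReal D →
      mdNorm (homogeneity γ) Γ α K (fun t => F t - G t) ≤ ENNReal.ofReal ε →
      mdHolder (homogeneity γ) Γ (α + γ - 1) K
          (fun t => taylorLift γ α f i (F t) - taylorLift γ α f i (G t)) ≤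
        ENNReal.ofReal (C * ε) := by
  set P := ⌈α / γ⌉₊
  have hP : 0 < P := Nat.ceil_pos.2 (div_pos hα hγ)
  set N : ℝ := ((smallForests d P).card : ℝ)
  have hN : 1 ≤ N := Nat.one_le_cast.2 (one_le_card_smallForests hP)
  obtain ⟨B, hB⟩ := exists_iteratedDeriv_bound (contDiff_succ_iff_deriv.1 hf).2.2 (N * D)
  obtain ⟨C, hC⟩ := exists_isTransport hγ hα.le hΓ i hK
  obtain ⟨E, hE⟩ := exists_truncNorm_compose_sub_sub_le (d := d) hP hf
    (one_le_mul_of_one_le_of_one_le hN hD) hB C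
  refine ⟨N * (|E| * N), fun {F G ε} hF hG hε hFD hGD hFG =>
    mdHolder_le_iff.2 fun t ht s hs h0 h1 β _ hβ => ?_⟩
  obtain ⟨g, hg⟩ := hΓ.mem t s
  have hD0 : 0 ≤ D := zero_le_one.trans hD
  have hdiff := twoPointBound_of_mdNorm_le (F := fun t => F t - G t) hγ hε
    (fun t => sub_mem (hF t) (hG t)) hFG ht hs h0 h1 hg
  simp only [map_sub] at hdiff
  have hnorm := hE (hC t ht s hs h0 h1 g hg)
    (twoPointBound_of_mdNorm_le hγ hD0 hG hGD ht hs h0 h1 hg)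
    (twoPointBound_of_mdNorm_le hγ hD0 hF hFD ht hs h0 h1 hg) hdiff
  rw [← hg, taylorLift_sub_sub_structAction hγ]
  refine ENNReal.ofReal_le_ofReal ((div_le_iff₀ (Real.rpow_pos_of_pos h0 _)).2 ?_)
  rw [mul_assoc, mul_assoc]
  refine homNorm_mulXi_le hγ i _ (by positivity) hβ fun ζ hζ hζβ => ?_
  have hexp : α + γ - 1 - β = α - γ * forestSize ζ := by
    rw [← hζβ, homogeneity]
    ring
  rw [AddMonoidAlgebra.coeff_sub, Finsupp.sub_apply, coeff_trunc, if_pos hζ, hexp,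
    ← Finsupp.sub_apply, ← AddMonoidAlgebra.coeff_sub, ← mul_assoc]
  refine abs_coeff_le_of_truncNorm_le h0 (hnorm.trans ?_) hζ
  calc E * ((nndist t s ^ α : NNReal) * (N * ε)) ≤ |E| * ((nndist t s ^ α : NNReal) * (N * ε)) := by
        gcongr
        exact le_abs_self E
    _ = _ := by
        rw [NNReal.coe_rpow, coe_nndist]
        ring

theorem exists_mdNorm_taylorLift_sub_le (hγ : 0 < γ) (hα : 0 < α)
    (hf : ContDiff ℝ (⌈α / γ⌉₊ + 1) f) (hΓ : IsBimap (homogeneity γ) (structureGroup d) Γ)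
    (i : Fin d) (hK : IsCompact K) (D : ℝ) :
    ∃ C : ℝ, 0 < C ∧ ∀ F G : ℝ → ModelSpace d, (∀ t, F t ∈ below (homogeneity γ) α) →
      (∀ t, G t ∈ below (homogeneity γ) α) →
      mdNorm (homogeneity γ) Γ α K F + mdNorm (homogeneity γ) Γ α K G ≤ ENNReal.ofReal D →
      mdNorm (homogeneity γ) Γ (α + γ - 1) K
          (fun t => taylorLift γ α f i (F t) - taylorLift γ α f i (G t)) ≤
        ENNReal.ofReal C * mdNorm (homogeneity γ) Γ α K (fun t => F t - G t) := by
  have hD : ENNReal.ofReal D ≤ ENNReal.ofReal (max 1 D) :=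
    ENNReal.ofReal_le_ofReal (le_max_right 1 D)
  obtain ⟨C₁, hC₁⟩ := exists_mdSup_taylorLift_sub_le (Γ := Γ) (K := K) hγ hα hf i (le_max_left 1 D)
  obtain ⟨C₂, hC₂⟩ := exists_mdHolder_taylorLift_sub_le hγ hα hf hΓ i hK (le_max_left 1 D)
  refine ⟨1 + |C₁| + |C₂|, by positivity, fun F G hF hG hFG => ?_⟩
  have hFD := (le_self_add.trans hFG).trans hD
  have hGD := (le_add_self.trans hFG).trans hD
  have hfin : mdNorm (homogeneity γ) Γ α K (fun t => F t - G t) ≠ ⊤ :=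
    (((mdNorm_sub_le F G).trans hFG).trans_lt ENNReal.ofReal_lt_top).ne
  rw [← ENNReal.ofReal_toReal hfin]
  set ε := (mdNorm (homogeneity γ) Γ α K fun t => F t - G t).toReal
  have hε : 0 ≤ ε := ENNReal.toReal_nonneg
  have hFG_le : mdNorm (homogeneity γ) Γ α K (fun t => F t - G t) ≤ ENNReal.ofReal ε :=
    (ENNReal.ofReal_toReal hfin).ge
  calc _ ≤ ENNReal.ofReal (C₁ * ε) + ENNReal.ofReal (C₂ * ε) :=
        add_le_add (hC₁ hF hG hε hFD hGD hFG_le) (hC₂ hF hG hε hFD hGD hFG_le)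
    _ ≤ ENNReal.ofReal (|C₁| * ε) + ENNReal.ofReal (|C₂| * ε) := by
        gcongr <;> exact le_abs_self _
    _ = ENNReal.ofReal ((|C₁| + |C₂|) * ε) := by
        rw [add_mul, ENNReal.ofReal_add (by positivity) (by positivity)]
    _ ≤ ENNReal.ofReal (1 + |C₁| + |C₂|) * ENNReal.ofReal ε := by
        rw [← ENNReal.ofReal_mul (by positivity)]
        gcongr
        linarith

theorem taylorLift_zero (hγ : 0 < γ) (hα : 0 < α) (f : ℝ → ℝ) (i : Fin d) :
    taylorLift γ α f i 0 = mulXi i (f 0 • 1) := by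
  have hP : 0 < ⌈α / γ⌉₊ := Nat.ceil_pos.2 (div_pos hα hγ)
  have hcompose : compose f ⌈α / γ⌉₊ (0 : ForestAlg d) = f 0 • 1 := by
    rw [compose, taylorSum, Finset.sum_eq_single_of_mem 0 (Finset.mem_range.2 hP) fun n _ hn => by
      simp [reduced, hn]]
    simp
  rw [taylorLift_eq hγ, map_zero, hcompose, map_smul, ← ofForest_zero, trunc_ofForest,
    if_pos (forestSize_zero.trans_lt hP)]

theorem mdNorm_taylorLift_zero_lt_top (hγ : 0 < γ) (hα : 0 < α) (f : ℝ → ℝ)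
    (hΓ : IsBimap (homogeneity γ) (structureGroup d) Γ) (i : Fin d) (K : Set ℝ) :
    mdNorm (homogeneity γ) Γ (α + γ - 1) K (fun _ => taylorLift γ α f i 0) < ⊤ := by
  have hl1 : l1Norm d (f 0 • 1) ≤ |f 0| := by
    rw [map_smul_eq_mul, Real.norm_eq_abs]
    exact mul_le_of_le_one_right (abs_nonneg _) isAlgSeminorm_l1Norm.one_le
  have hsup : mdSup (homogeneity γ) (α + γ - 1) K (fun _ => taylorLift γ α f i 0) ≤
      ENNReal.ofReal ((smallForests d ⌈α / γ⌉₊).card * |f 0|) := by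
    refine mdSup_le_iff.2 fun t _ β _ hβ => ENNReal.ofReal_le_ofReal ?_
    rw [taylorLift_zero hγ hα]
    exact homNorm_mulXi_le hγ i _ (abs_nonneg _) hβ fun ζ _ _ =>
      (abs_coeff_le_l1Norm _ ζ).trans hl1
  have hholder : mdHolder (homogeneity γ) Γ (α + γ - 1) K (fun _ => taylorLift γ α f i 0) ≤ 0 := by
    refine mdHolder_le_iff.2 fun t _ s _ _ _ β _ _ => ?_
    obtain ⟨g, hg⟩ := hΓ.mem t s
    rw [taylorLift_zero hγ hα, ← hg, structAction_mulXi, map_smul (charAction g), map_one, sub_self,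
      homNorm_zero, zero_div, ENNReal.ofReal_zero]
  exact (add_le_add hsup hholder).trans_lt (by rw [add_zero]; exact ENNReal.ofReal_lt_top)

theorem mdNorm_taylorLift_lt_top (hγ : 0 < γ) (hα : 0 < α) (hf : ContDiff ℝ (⌈α / γ⌉₊ + 1) f)
    (hΓ : IsBimap (homogeneity γ) (structureGroup d) Γ) (i : Fin d) (hK : IsCompact K)
    (hF : ∀ t, F t ∈ below (homogeneity γ) α) (hF_lt : mdNorm (homogeneity γ) Γ α K F < ⊤) :
    mdNorm (homogeneity γ) Γ (α + γ - 1) K (fun t => taylorLift γ α f i (F t)) < ⊤ := by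
  obtain ⟨C, -, hC⟩ := exists_mdNorm_taylorLift_sub_le hγ hα hf hΓ i hK
    (mdNorm (homogeneity γ) Γ α K F).toReal
  have hsub := hC F 0 hF (fun _ => zero_mem _) (by
    rw [ENNReal.ofReal_toReal hF_lt.ne]
    exact (congrArg (_ + ·) mdNorm_zero).trans (add_zero _) |>.le)
  simp only [Pi.zero_apply, sub_zero] at hsub
  have htriangle := mdNorm_sub_le_add (deg := homogeneity γ) (Γ := Γ) (η := α + γ - 1) (K := K)
    (fun t => taylorLift γ α f i (F t)) (fun _ => taylorLift γ α f i 0) 0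
  simp only [Pi.zero_apply, sub_zero] at htriangle
  exact htriangle.trans_lt (ENNReal.add_lt_top.2
    ⟨hsub.trans_lt (ENNReal.mul_lt_top ENNReal.ofReal_lt_top hF_lt),
      mdNorm_taylorLift_zero_lt_top hγ hα f hΓ i K⟩)

/-- The map `Y ↦ (f(Y) Ξ_i)_{α+γ-1}` between spaces of modelled distributions. -/
def composeXi (hγ : 0 < γ) (hα : 0 < α) (hf : ContDiff ℝ (⌈α / γ⌉₊ + 1) f)
    (hΓ : IsBimap (homogeneity γ) (structureGroup d) Γ) (i : Fin d)
    (Y : ModelledDistribution (homogeneity γ) Γ (sectorY d) α) :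
    ModelledDistribution (homogeneity γ) Γ (sectorYdot d) (α + γ - 1) where
  toFun t := taylorLift γ α f i (Y t)
  mem t := taylorLift_mem hγ f i (Y t)
  finite K hK := mdNorm_taylorLift_lt_top hγ hα hf hΓ i hK (fun t => (Y.mem t).2) (Y.finite K hK)

end LocalLipschitz

end

end BranchedRS

theorem mainTheorem11_general {d : ℕ} (i : Fin d) (γ : ℝ) (hγ : 0 < γ) (α : ℝ) (hα : 0 < α)
    (k : ℕ) (hk : α / γ + 1 ≤ (k : ℝ)) (f : ℝ → ℝ) (hf : ContDiff ℝ k f)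
    {Γ : ℝ → ℝ → (BranchedRS.ModelSpace d →ₗ[ℝ] BranchedRS.ModelSpace d)}
    (hΓ : BranchedRS.IsBimap (BranchedRS.homogeneity γ) (BranchedRS.structureGroup d) Γ) :
    ∃ Φ : BranchedRS.ModelledDistribution (BranchedRS.homogeneity γ) Γ (BranchedRS.sectorY d) α →
        BranchedRS.ModelledDistribution (BranchedRS.homogeneity γ) Γ
          (BranchedRS.sectorYdot d) (α + γ - 1),
      (∀ Y t, Φ Y t = BranchedRS.taylorLift γ α f i (Y t)) ∧
      Continuous Φ ∧
      ∀ K : Set ℝ, IsCompact K → ∀ D : ℝ, 0 < D → ∃ C : ℝ, 0 < C ∧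
        ∀ F G : BranchedRS.ModelledDistribution (BranchedRS.homogeneity γ) Γ
            (BranchedRS.sectorY d) α,
          BranchedRS.mdNorm (BranchedRS.homogeneity γ) Γ α K F +
              BranchedRS.mdNorm (BranchedRS.homogeneity γ) Γ α K G ≤ ENNReal.ofReal D →
          BranchedRS.mdNorm (BranchedRS.homogeneity γ) Γ (α + γ - 1) K
              (fun t => Φ F t - Φ G t) ≤
            ENNReal.ofReal C *
              BranchedRS.mdNorm (BranchedRS.homogeneity γ) Γ α K (fun t => F t - G t) := by
  have hceil : ⌈α / γ⌉₊ + 1 ≤ k := by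
    rwa [← Nat.ceil_add_one (div_pos hα hγ).le, Nat.ceil_le]
  have hf' : ContDiff ℝ (⌈α / γ⌉₊ + 1) f := hf.of_le (by exact_mod_cast hceil)
  have hlip K (hK : IsCompact K) D :=
    BranchedRS.exists_mdNorm_taylorLift_sub_le hγ hα hf' hΓ i hK D
  refine ⟨BranchedRS.composeXi hγ hα hf' hΓ i, fun _ _ => rfl,
    BranchedRS.continuous_of_locally_lipschitz _ fun K hK D _ => ?_, fun K hK D _ => ?_⟩ <;>
    obtain ⟨C, hC, hle⟩ := hlip K hK D
  · exact ⟨C, fun F G => hle F G (fun t => (F.mem t).2) fun t => (G.mem t).2⟩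
  · exact ⟨C, hC, fun F G => hle F G (fun t => (F.mem t).2) fun t => (G.mem t).2⟩

theorem mainTheorem11 {d : ℕ} (i : Fin d) (γ : ℝ) (hγ : γ ∈ Set.Ioo (0 : ℝ) 1)
    (α : ℝ) (hα : 0 < α) (k : ℕ) (hk : α / γ + 1 ≤ (k : ℝ))
    (f : ℝ → ℝ) (hf : ContDiff ℝ k f) (M : BranchedRS.BranchedModel d γ) :
    ∃ Φ : BranchedRS.ModelledDistribution (BranchedRS.homogeneity γ) M.Gam
          (BranchedRS.sectorY d) α →
        BranchedRS.ModelledDistribution (BranchedRS.homogeneity γ) M.Gam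
          (BranchedRS.sectorYdot d) (α + γ - 1),
      (∀ Y t, Φ Y t = BranchedRS.taylorLift γ α f i (Y t)) ∧
      Continuous Φ ∧
      ∀ K : Set ℝ, IsCompact K → ∀ D : ℝ, 0 < D → ∃ C : ℝ, 0 < C ∧
        ∀ F G : BranchedRS.ModelledDistribution (BranchedRS.homogeneity γ) M.Gam
            (BranchedRS.sectorY d) α,
          BranchedRS.mdNorm (BranchedRS.homogeneity γ) M.Gam α K F +
              BranchedRS.mdNorm (BranchedRS.homogeneity γ) M.Gam α K G ≤ ENNReal.ofReal D →
          BranchedRS.mdNorm (BranchedRS.homogeneity γ) M.Gam (α + γ - 1) K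
              (fun t => Φ F t - Φ G t) ≤
            ENNReal.ofReal C *
              BranchedRS.mdNorm (BranchedRS.homogeneity γ) M.Gam α K (fun t => F t - G t) :=
  mainTheorem11_general i γ hγ.1 α hα k hk f hf M.isBimap
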